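/- **Conventions.** Let $\mathfrak M$ be an infinite structure in an arbitrary first-order language that is $\kappa$-saturated for some infinite cardinal $\kappa$ (in particular, $\mathfrak M$ may be any infinite saturated model of a complete theory). Let $M$ be its universe and let $\varphi(\mathbf x,\mathbf y)$ be a formula in two finite tuples of variables, where $\mathbf y$ is non-empty. For $A\subseteq M^{|\mathbf y|}$ let $S_\varphi(A)$ be the set of $\varphi$-types over $A$, that is, of maximal consistent sets of formulas $\pm\varphi(\mathbf x,\mathbf a)$ with $\mathbf a\in A$. Such a type is identified with the set of those $\mathbf a\in A$ for which $\varphi(\mathbf x,\mathbf a)$ belongs to it, so that $S_\varphi(A)\subseteq\mathcal P(A)$. * $\mathrm{VCd}(\varphi)\in[-\infty,\infty]$ is the infimum of all $r\in\mathbb R$ for which there is $K\in\mathbb N$ with $|S_\varphi(A)|<K|A|^r$ for all finite non-empty $A\subseteq M^{|\mathbf y|}$. * $\mathrm{VCd}_{\mathrm{ind}}(\varphi)\in[-\infty,\infty]$ is the infimum of all $r\in\mathbb R$ for which there is $K\in\mathbb N$ with $|S_\varphi(\{\mathbf b_0,\dots,\mathbf b_{N-1}\})|<KN^r$ for all $N\ge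 1$ and all sequences $(\mathbf b_i)_{i<N}$ in $M^{|\mathbf y|}$ that are indiscernible over $\emptyset$. * For $d\in\mathbb N\cup\{\infty\}$ put $\binom{n}{\le d}=\sum_{i=0}^{d}\binom ni$ if $d<n$ and $\binom n{\le d}=2^n$ otherwise. A set system $\mathcal C\subseteq\mathcal P(A)$ is *$d$-maximum* on $A$ if $|\{C\cap F:C\in\mathcal C\}|=\binom{|F|}{\le d}$ for every finite $F\subseteq A$. (So $\infty$-maximum means that every finite subset of $A$ is shattered.) * $\varphi$ *traces an infinite $d$-maximum set system* if there are an infinite set $A\subseteq M^{|\mathbf y|}$ and a set system $\mathcal C\subseteq S_\varphi(A)$ that is $d$-maximum on $A$. **Statement.** 1. For every such $\mathfrak M$ and $\varphi$: $\mathrm{VCd}(\varphi)=\mathrm{VCd}_{\mathrm{ind}}(\varphi)$ if and only if $d:=\mathrm{VCd}(\varphi)$ belongs to $\mathbb N\cup\{\infty\}$ and $\varphi$ traces an infinite $d$-maximum set system. 2. Let $\mathfrak M$ be a real closed field, considered in the language of rings, that is $\kappa$-saturated for some infinite $\kappa$. Let $d\ge 0$, let $\mathbf y$ be a non-empty finite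 tuple of variables, let $u_0,\dots,u_d$ be distinct monomials in $\mathbf y$ (with coefficient $1$), and let $\varphi(\mathbf x,\mathbf y)$, with $\mathbf x=(x_1,\dots,x_d)$, be a formula that defines in $\mathfrak M$ the polynomial inequality $$u_0(\mathbf y)+x_1u_1(\mathbf y)+\dots+x_du_d(\mathbf y)\ge 0 .$$ Then $\mathrm{VCd}(\varphi)=d=\mathrm{VCd}_{\mathrm{ind}}(\varphi)$. -/

import Mathlib

open scoped Cardinal

universe u v w

namespace VCMax

noncomputable section

/-! ### Set systems -/

/-- The number `binom(n, ≤ d)`: it is `∑_{i ≤ d} binom(n, i)` if `d < n`, and `2 ^ n` otherwise.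
For `d = ∞` it is `2 ^ n`. -/
def binomLE (n : ℕ) (d : ℕ∞) : ℕ :=
  if d < (n : ℕ∞) then ∑ i ∈ Finset.range (d.toNat + 1), n.choose i else 2 ^ n

/-- The trace `{C ∩ A : C ∈ 𝒞}` of a set system on a set `A`. -/
def traceOn {X : Type w} (𝒞 : Set (Set X)) (A : Set X) : Set (Set X) :=
  {B | ∃ C ∈ 𝒞, B = C ∩ A}

/-- `𝒞` is a `d`-maximum system of subsets of the ground set `X`: for every finite `A ⊆ X`, the
trace of `𝒞` on `A` has exactly `binom(|A|, ≤ d)` elements. For `d = ∞` this says that every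
finite subset of `X` is shattered. -/
def IsMaximum {Y : Type w} (d : ℕ∞) (X : Set Y) (𝒞 : Set (Set Y)) : Prop :=
  (∀ C ∈ 𝒞, C ⊆ X) ∧
    ∀ A : Finset Y, (A : Set Y) ⊆ X → (traceOn 𝒞 (A : Set Y)).ncard = binomLE A.card d

/-! ### Model-theoretic notions -/

/-- `M` is `κ`-saturated: for every `A ⊆ M` with `|A| < κ` and every `n`, each set of formulas in
`n` free variables with parameters in `A` that is finitely satisfiable in `M` is realized in `M`.
A formula with parameters in `A` is a formula some of whose free variables are instantiated by
elements of `A`. -/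
def IsSaturated (L : FirstOrder.Language.{u, v}) (M : Type w) [L.Structure M] (κ : Cardinal.{w}) : Prop :=
  ∀ A : Set M, #A < κ → ∀ (n : ℕ) (p : Set (L.Formula (A ⊕ Fin n))),
    (∀ p₀ : Finset (L.Formula (A ⊕ Fin n)), (p₀ : Set (L.Formula (A ⊕ Fin n))) ⊆ p →
      ∃ m : Fin n → M, ∀ ψ ∈ p₀, ψ.Realize (Sum.elim (fun a : A => (a : M)) m)) →
    ∃ m : Fin n → M, ∀ ψ ∈ p, ψ.Realize (Sum.elim (fun a : A => (a : M)) m)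

/-- A finite sequence `b₀, …, b_{N-1}` of `k`-tuples is indiscernible (over `∅`): any two
increasing subsequences of the same length satisfy the same formulas. -/
def IsIndiscernible (L : FirstOrder.Language.{u, v}) {M : Type w} [L.Structure M] {k N : ℕ}
    (b : Fin N → Fin k → M) : Prop :=
  ∀ (n : ℕ) (f g : Fin n → Fin N), StrictMono f → StrictMono g →
    ∀ ψ : L.Formula (Fin n × Fin k),
      ψ.Realize (fun p => b (f p.1) p.2) ↔ ψ.Realize (fun p => b (g p.1) p.2)

section

variable {L : FirstOrder.Language.{u, v}} {M : Type w} [L.Structure M] {l k : ℕ}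

/-- `S_φ(A)`, the set of `φ`-types over a set `A` of `k`-tuples. A `φ`-type over `A`, i.e. a maximal
consistent set of instances `± φ(x, a)` with `a ∈ A`, is identified with the set `B ⊆ A` of those
`a` for which `φ(x, a)` occurs positively; consistency with the elementary diagram of `M` is finite
satisfiability in `M`. -/
def phiTypes (φ : L.Formula (Fin l ⊕ Fin k)) (A : Set (Fin k → M)) : Set (Set (Fin k → M)) :=
  {B | B ⊆ A ∧ ∀ F : Finset (Fin k → M), (F : Set (Fin k → M)) ⊆ A →
    ∃ b : Fin l → M, ∀ a ∈ F, φ.Realize (Sum.elim b a) ↔ a ∈ B}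

/-- `φ` traces the set system `𝒞` on the ground set `A` of `k`-tuples. -/
def Traces (φ : L.Formula (Fin l ⊕ Fin k)) (A : Set (Fin k → M)) (𝒞 : Set (Set (Fin k → M))) :
    Prop :=
  𝒞 ⊆ phiTypes φ A

variable (M)

/-- `r` is an admissible exponent for the VC-density of `φ`: for some `K`, `|S_φ(A)| < K |A| ^ r`
for all finite nonempty `A`. -/
def VCDensityBound (φ : L.Formula (Fin l ⊕ Fin k)) (r : ℝ) : Prop :=
  ∃ K : ℕ, ∀ A : Finset (Fin k → M), A.Nonempty →
    ((phiTypes φ (A : Set (Fin k → M))).ncard : ℝ) < (K : ℝ) * (A.card : ℝ) ^ r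

/-- `r` is an admissible exponent for the `VC_ind`-density of `φ`: for some `K`,
`|S_φ(range b)| < K N ^ r` for every indiscernible sequence `b` of finite length `N ≥ 1`. -/
def VCIndDensityBound (φ : L.Formula (Fin l ⊕ Fin k)) (r : ℝ) : Prop :=
  ∃ K : ℕ, ∀ N : ℕ, 1 ≤ N → ∀ b : Fin N → Fin k → M, IsIndiscernible L b →
    ((phiTypes φ (Set.range b)).ncard : ℝ) < (K : ℝ) * (N : ℝ) ^ r

/-- The VC-density of `φ` in `M`, the infimum of the admissible exponents (`∞` if there are
none). -/
def VCd (φ : L.Formula (Fin l ⊕ Fin k)) : EReal :=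
  sInf ((fun r : ℝ => (r : EReal)) '' {r | VCDensityBound M φ r})

/-- The `VC_ind`-density of `φ` in `M`, the infimum of the admissible exponents (`∞` if there are
none). -/
def VCdInd (φ : L.Formula (Fin l ⊕ Fin k)) : EReal :=
  sInf ((fun r : ℝ => (r : EReal)) '' {r | VCIndDensityBound M φ r})

end

/-- The value at `(c, y)` of the polynomial `u₀(y) + c₁ u₁(y) + ⋯ + c_d u_d(y)`, where `u_i` is the
monomial in `y = (y₁, …, y_k)` with exponent vector `e i`. -/
def polyValue {M : Type w} [CommSemiring M] {d k : ℕ} (e : Fin (d + 1) → Fin k → ℕ)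
    (c : Fin d → M) (y : Fin k → M) : M :=
  (∏ j, y j ^ e 0 j) + ∑ i : Fin d, c i * ∏ j, y j ^ e i.succ j

end

end VCMax

/-! Part 1. Fix letters `c` and read a 0/1 word with a predictor that guesses `c m` after `m`
mistakes. The words with at most d mistakes form a d-maximum system: on a finite F they correspond
to the subsets of F of size at most d, namely the mistakes made when the predictor is run on F alone
(`isMaximum_wordSystem`). Conversely, all but O(N^d) words of length N contain, for some `c`, every
word of length n with at most d + 1 mistakes as a subword (`Rich.sublist`,
`exists_ncard_poorWords_le`). So if the number of types over indiscernible sequences is not O(N^d),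
some realized pattern is of this kind; indiscernibility moves its subwords to one initial segment,
and saturation then yields an infinite (d+1)-maximum trace
(`vcIndDensityBound_of_not_tracesMaximum`).

In the other direction, an iterated ultrafilter turns an infinite set carrying a d-maximum system
into indiscernible sequences with at least binom(N, ≤ d) types
(`exists_isIndiscernible_binomLE_le`). Hence `VCdInd` is d if d + 1 is the least value that is not
traced, and ∞ if every finite value is traced. Together with `VCdInd ≤ VCd` this gives the
characterization.

Part 2. A linear relation among d + 1 affine functionals on M^d excludes one of their sign patterns,
so Sauer–Shelah gives `VCd ≤ d`. For the lower bound, evaluate the monomials at points where they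
become 9^(t n) with distinct n. Alternating coefficients of suitable sizes make the dominant term,
and with it the sign, change at prescribed times t; this realizes all words with at most d mistakes
for an alternating `c`. -/

namespace VCMax

noncomputable section

/-! ### Words described by the mistakes of a predictor -/

/-- The number of `j < i` with `p j = true`. -/
def mistakes (p : ℕ → Bool) (i : ℕ) : ℕ := Nat.count (fun j => p j = true) i

/-- The word whose `i`-th letter is predicted to be `c m`, where `m` is the number of mistakes made
before `i`; the prediction is wrong exactly at the places marked by `p`. -/
def word (c : ℕ → Bool) (p : ℕ → Bool) (i : ℕ) : Bool := (c (mistakes p i)) ^^ (p i)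

lemma mistakes_succ (p : ℕ → Bool) (i : ℕ) :
    mistakes p (i + 1) = mistakes p i + if p i = true then 1 else 0 := Nat.count_succ _ _

lemma mistakes_add (p : ℕ → Bool) (a b : ℕ) :
    mistakes p (a + b) = mistakes p a + mistakes (fun k => p (a + k)) b := Nat.count_add _ _ _

lemma mistakes_mono (p : ℕ → Bool) : Monotone (mistakes p) := Nat.count_monotone _

lemma mistakes_eq_card (p : ℕ → Bool) (i : ℕ) :
    mistakes p i = ((Finset.range i).filter fun j => p j = true).card :=
  Nat.count_eq_card_filter_range _ _

/-- The indicator of a finite set of natural numbers. -/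
def indicator (E : Finset ℕ) (i : ℕ) : Bool := decide (i ∈ E)

lemma mistakes_indicator (E : Finset ℕ) (i : ℕ) :
    mistakes (indicator E) i = (E.filter (· < i)).card := by
  rw [mistakes_eq_card]
  congr 1
  ext j
  simp [indicator, and_comm]

lemma mistakes_indicator_le (E : Finset ℕ) (i : ℕ) : mistakes (indicator E) i ≤ E.card := by
  rw [mistakes_indicator]
  exact Finset.card_filter_le _ _

lemma word_congr {c c' p : ℕ → Bool} {e : ℕ} (hp : ∀ m, mistakes p m ≤ e)
    (h : ∀ j ≤ e, c j = c' j) : word c p = word c' p := by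
  funext i
  simp [word, h _ (hp i)]

lemma word_shift (c p : ℕ → Bool) (a i : ℕ) :
    word c p (a + i) = word (fun j => c (mistakes p a + j)) (fun k => p (a + k)) i := by
  simp [word, mistakes_add]

/-- The mistakes can be read off from left to right: once the sets agree below `i`, both predictions
at `i` coincide, and the letter at `i` decides membership of `i`. -/
lemma eq_of_word_eq (c : ℕ → Bool) {F E E' : Finset ℕ} (hE : E ⊆ F) (hE' : E' ⊆ F)
    (h : ∀ i ∈ F, word c (indicator E) i = word c (indicator E') i) : E = E' := by
  have key : ∀ i, i ∈ E ↔ i ∈ E' := by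
    intro i
    induction i using Nat.strong_induction_on with
    | _ i ih =>
      have hc : mistakes (indicator E) i = mistakes (indicator E') i := by
        rw [mistakes_indicator, mistakes_indicator]
        congr 1
        ext j
        simp only [Finset.mem_filter]
        constructor
        · rintro ⟨h1, h2⟩; exact ⟨(ih j h2).1 h1, h2⟩
        · rintro ⟨h1, h2⟩; exact ⟨(ih j h2).2 h1, h2⟩
      by_cases hi : i ∈ F
      · have := h i hi
        simp only [word, hc, indicator] at this
        simpa using this
      · exact ⟨fun h1 => (hi (hE h1)).elim, fun h1 => (hi (hE' h1)).elim⟩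
  ext i
  exact key i

/-- The set `E` collects the mistakes of the predictor when it sees only the places in `F`. The
bound on mistakes, carried through the induction, shows that ignoring the other places never costs
extra mistakes. -/
lemma exists_subset_word_eq (c p : ℕ → Bool) (F : Finset ℕ) :
    ∃ E ⊆ F, (∀ i ∈ F, word c (indicator E) i = word c p i) ∧
      ∀ m, mistakes (indicator E) m ≤ mistakes p m := by
  induction F using Finset.induction_on_max with
  | empty => exact ⟨∅, by simp, by simp, fun m => by simp [mistakes_indicator]⟩
  | insert a F hF ih =>
    obtain ⟨E, hEF, hw, hm⟩ := ih
    have haE : a ∉ E := fun h => lt_irrefl _ (hF a (hEF h))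
    have hbelow : ∀ m ≤ a, mistakes (indicator (insert a E)) m = mistakes (indicator E) m := by
      intro m hma
      rw [mistakes_indicator, mistakes_indicator, Finset.filter_insert, if_neg (not_lt.2 hma)]
    have hind : ∀ i ∈ F, indicator (insert a E) i = indicator E i := by
      intro i hi
      have := (hF i hi).ne
      simp [indicator, this]
    by_cases hwa : word c (indicator E) a = word c p a
    · refine ⟨E, hEF.trans (Finset.subset_insert _ _), ?_, hm⟩
      intro i hi
      rcases Finset.mem_insert.1 hi with rfl | hi
      · exact hwa
      · exact hw i hi
    · refine ⟨insert a E, Finset.insert_subset_insert _ hEF, ?_, ?_⟩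
      · intro i hi
        rcases Finset.mem_insert.1 hi with rfl | hi
        · have h1 : indicator E i = false := by simp [indicator, haE]
          have h2 : indicator (insert i E) i = true := by simp [indicator]
          simp only [word, h1, hbelow i le_rfl, h2] at hwa ⊢
          revert hwa
          cases c (mistakes (indicator E) i) <;> cases c (mistakes p i) <;> cases p i <;> simp
        · rw [← hw i hi]
          simp only [word, hbelow i (hF i hi).le, hind i hi]
      · intro m
        rcases le_or_gt m a with hma | hma
        · rw [hbelow m hma]; exact hm m
        · have h1 : mistakes (indicator (insert a E)) m ≤ mistakes (indicator E) a + 1 := by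
            rw [mistakes_indicator, mistakes_indicator]
            refine (Finset.card_le_card (t := insert a (E.filter (· < a))) ?_).trans
              (Finset.card_insert_le _ _)
            intro j hj
            rw [Finset.mem_filter, Finset.mem_insert] at hj
            rcases hj.1 with rfl | hjE
            · simp
            · exact Finset.mem_insert_of_mem (Finset.mem_filter.2 ⟨hjE, hF j (hEF hjE)⟩)
          have h2 : mistakes p (a + 1) ≤ mistakes p m := mistakes_mono p hma
          rw [mistakes_succ] at h2
          have h3 := hm a
          -- With fewer mistakes than `p` before `a` there is room for one more. With equally many,
          -- both predictions at `a` agree, so a wrong letter there is also a mistake of `p`.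
          rcases h3.lt_or_eq with h4 | h4
          · omega
          · have : p a = true := by
              have h5 : indicator E a = false := by simp [indicator, haE]
              simp only [word, h4, h5] at hwa
              revert hwa
              cases c (mistakes p a) <;> cases p a <;> simp
            simp only [this, if_true] at h2
            omega

lemma card_powerset_filter_card_le (F : Finset ℕ) (d : ℕ) :
    (F.powerset.filter fun E => E.card ≤ d).card = binomLE F.card d := by
  unfold binomLE
  split_ifs with h
  · have : (F.powerset.filter fun E => E.card ≤ d) =
        (Finset.range (d + 1)).biUnion fun i => F.powersetCard i := by
      ext E
      simp only [Finset.mem_filter, Finset.mem_powerset, Finset.mem_biUnion, Finset.mem_range,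
        Finset.mem_powersetCard]
      constructor
      · rintro ⟨h1, h2⟩; exact ⟨_, by omega, h1, rfl⟩
      · rintro ⟨i, h1, h2, rfl⟩; exact ⟨h2, by omega⟩
    rw [this, Finset.card_biUnion]
    · simp
    · intro i _ j _ hij
      exact Finset.pairwise_disjoint_powersetCard F hij
  · rw [Finset.filter_true_of_mem, Finset.card_powerset]
    intro E hE
    have h1 := Finset.card_le_card (Finset.mem_powerset.1 hE)
    have h2 : F.card ≤ d := by simpa using h
    omega

lemma choose_le_binomLE (N e : ℕ) : N.choose e ≤ binomLE N e := by
  unfold binomLE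
  split_ifs with h
  · exact Finset.single_le_sum (f := fun i => N.choose i) (fun _ _ => Nat.zero_le _)
      (by simp)
  · exact Nat.choose_le_two_pow _ _

/-- The sets of terms of the sequence `a` marked by the words with at most `d` mistakes. -/
def wordSystem {X : Type w} (c : ℕ → Bool) (a : ℕ → X) (d : ℕ) : Set (Set X) :=
  {C | ∃ p : ℕ → Bool, (∀ m, mistakes p m ≤ d) ∧ C = a '' {i | word c p i = true}}

lemma isMaximum_wordSystem {X : Type w} (c : ℕ → Bool) {a : ℕ → X} (ha : Function.Injective a)
    (d : ℕ) : IsMaximum d (Set.range a) (wordSystem c a d) := by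
  classical
  refine ⟨?_, ?_⟩
  · rintro _ ⟨p, -, rfl⟩
    exact Set.image_subset_range _ _
  intro A hA
  obtain ⟨F, rfl⟩ : ∃ F : Finset ℕ, A = F.image a := by
    refine ⟨A.preimage a ha.injOn, ?_⟩
    ext x
    simp only [Finset.mem_image, Finset.mem_preimage]
    constructor
    · intro hx
      obtain ⟨i, rfl⟩ := hA hx
      exact ⟨i, hx, rfl⟩
    · rintro ⟨i, hi, rfl⟩; exact hi
  rw [Finset.card_image_of_injective _ ha, ← card_powerset_filter_card_le, ← Set.ncard_coe_finset]
  symm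
  have hmem : ∀ (p : ℕ → Bool) (i : ℕ), a i ∈ (a '' {i | word c p i = true} ∩
      ((F.image a : Finset X) : Set X)) ↔ word c p i = true ∧ i ∈ F := by
    intro p i
    rw [Set.mem_inter_iff, ha.mem_set_image, Finset.mem_coe, ha.mem_finset_image]
    rfl
  refine Set.ncard_congr (fun E _ => a '' {i | word c (indicator E) i = true} ∩
      ((F.image a : Finset X) : Set X)) ?_ ?_ ?_
  · intro E hE
    simp only [Finset.coe_filter, Finset.mem_powerset, Set.mem_ofPred_eq] at hE
    exact ⟨_, ⟨_, fun m => (mistakes_indicator_le E m).trans hE.2, rfl⟩, rfl⟩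
  · intro E E' hE hE' h
    simp only [Finset.coe_filter, Finset.mem_powerset, Set.mem_ofPred_eq] at hE hE'
    refine eq_of_word_eq c hE.1 hE'.1 fun i hi => ?_
    have h1 := hmem (indicator E) i
    rw [h, hmem] at h1
    simp only [hi, and_true] at h1
    exact (Bool.eq_iff_iff.2 h1).symm
  · rintro _ ⟨_, ⟨p, hp, rfl⟩, rfl⟩
    obtain ⟨E, hEF, hw, hm⟩ := exists_subset_word_eq c p F
    refine ⟨E, ?_, ?_⟩
    · simp only [Finset.coe_filter, Finset.mem_powerset, Set.mem_ofPred_eq]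
      refine ⟨hEF, ?_⟩
      -- The place `F.sup id + 1` lies beyond all of `F`, so the count there is the cardinality of
      -- `E`.
      have h1 := (hm (F.sup id + 1)).trans (hp _)
      rwa [mistakes_indicator, Finset.filter_true_of_mem] at h1
      intro i hi
      exact Nat.lt_succ_of_le (Finset.le_sup (f := id) (hEF hi))
    · ext x
      by_cases hx : x ∈ F.image a
      · obtain ⟨i, hi, rfl⟩ := Finset.mem_image.1 hx
        rw [hmem, hmem, hw i hi]
      · exact iff_of_false (fun h => hx (Finset.mem_coe.1 h.2)) fun h => hx (Finset.mem_coe.1 h.2)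

/-! ### Counting words without long alternating patterns -/

/-- `w` contains `c₀ⁿ (¬c₀) c₁ⁿ (¬c₁) ⋯ (¬c_{e-1}) c_eⁿ` as a (not necessarily contiguous)
subword. -/
def Rich (n : ℕ) : ℕ → (ℕ → Bool) → List Bool → Prop
  | 0, c, w => n ≤ w.count (c 0)
  | e + 1, c, w => ∃ w₁ w₂, w = w₁ ++ (!c 0) :: w₂ ∧ n ≤ w₁.count (c 0) ∧
      Rich n e (fun i => c (i + 1)) w₂

/-- A block of `n` letters `c i` accommodates any run of correct guesses, and the letter `!c i`
after it accommodates the next mistake. The induction cuts the word at the first mistake of `p`. -/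
lemma Rich.sublist {n e : ℕ} {c : ℕ → Bool} {w : List Bool} (h : Rich n e c w) {p : ℕ → Bool}
    {m : ℕ} (hm : m ≤ n) (hp : mistakes p m ≤ e) : ((List.range m).map (word c p)).Sublist w := by
  have hrep : ∀ (c p : ℕ → Bool) (i : ℕ), (∀ j < i, p j = false) →
      (List.range i).map (word c p) = List.replicate i (c 0) := by
    intro c p i hi
    have h0 : ∀ j ≤ i, mistakes p j = 0 := by
      intro j hj
      rw [mistakes_eq_card, Finset.card_eq_zero, Finset.filter_eq_empty_iff]
      intro k hk
      simp [hi k (lt_of_lt_of_le (Finset.mem_range.1 hk) hj)]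
    rw [List.eq_replicate_iff]
    refine ⟨by simp, ?_⟩
    intro x hx
    obtain ⟨j, hj, rfl⟩ := List.mem_map.1 hx
    rw [List.mem_range] at hj
    simp [word, h0 j hj.le, hi j hj]
  induction e generalizing c w p m with
  | zero =>
    have hi : ∀ j < m, p j = false := by
      intro j hj
      by_contra hc
      have h1 := mistakes_mono p (Nat.succ_le_of_lt hj)
      rw [Nat.succ_eq_add_one, mistakes_succ] at h1
      rw [if_pos (by simpa using hc)] at h1
      omega
    rw [hrep c p m hi, List.replicate_sublist_iff]
    exact hm.trans h
  | succ e ih =>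
    obtain ⟨w₁, w₂, rfl, h₁, h₂⟩ := h
    by_cases hi : ∀ j < m, p j = false
    · rw [hrep c p m hi]
      exact (List.replicate_sublist_iff.2 (hm.trans h₁)).trans (List.sublist_append_left _ _)
    · have hex : ∃ j, j < m ∧ p j = true := by
        push Not at hi
        simpa using hi
      classical
      obtain ⟨hi0m, hpi0⟩ := Nat.find_spec hex
      have hmin : ∀ j < Nat.find hex, p j = false := by
        intro j hj
        have := Nat.find_min hex hj
        rw [Bool.eq_false_iff]
        exact fun h => this ⟨hj.trans hi0m, h⟩
      generalize Nat.find hex = i at hi0m hpi0 hmin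
      have hmi : mistakes p i = 0 := by
        rw [mistakes_eq_card, Finset.card_eq_zero, Finset.filter_eq_empty_iff]
        intro k hk
        simp [hmin k (Finset.mem_range.1 hk)]
      have hmi1 : mistakes p (i + 1) = 1 := by simp [mistakes_succ, hmi, hpi0]
      obtain ⟨r, rfl⟩ : ∃ r, m = i + 1 + r := ⟨m - (i + 1), by omega⟩
      have hsplit : (List.range (i + 1 + r)).map (word c p) =
          List.replicate i (c 0) ++ (!c 0) ::
            (List.range r).map (word (fun j => c (j + 1)) (fun k => p (i + 1 + k))) := by
        rw [List.range_add, List.map_append, List.range_succ, List.map_append, hrep c p i hmin]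
        simp only [List.map_cons, List.map_nil, List.append_assoc, List.map_map,
          List.cons_append, List.nil_append]
        congr 2
        · simp [word, hmi, hpi0]
        · apply List.map_congr_left
          intro j _
          simp only [Function.comp, word_shift, hmi1]
          congr 1
          funext j
          rw [add_comm]
      rw [hsplit]
      refine List.Sublist.append (List.replicate_sublist_iff.2 (by omega)) (List.Sublist.cons_cons _ ?_)
      refine ih h₂ (by omega) ?_
      rw [mistakes_add, hmi1] at hp
      omega

/-- Words of length `N` that are rich for no sequence of letters. -/
def poorWords (n e N : ℕ) : Set (List Bool) := {w | w.length = N ∧ ∀ c, ¬ Rich n e c w}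

lemma finite_poorWords (n e N : ℕ) : (poorWords n e N).Finite :=
  (List.finite_length_eq Bool N).subset fun _ h => h.1

lemma exists_count_le {n : ℕ} {w : List Bool} (h : 2 * n ≤ w.length) :
    ∃ a, n ≤ w.count a := by
  have := List.count_true_add_count_false w
  by_contra! hc
  have h1 := hc true
  have h2 := hc false
  omega

lemma poorWords_zero {n N : ℕ} (h : 2 * n ≤ N) : poorWords n 0 N = ∅ := by
  ext w
  simp only [poorWords, Set.mem_ofPred_eq, Set.mem_empty_iff_false, iff_false, not_and]
  rintro rfl hc
  obtain ⟨a, ha⟩ := exists_count_le h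
  exact hc (fun _ => a) ha

/-- Words of length `N` in which every occurrence of the letter `!a` is followed by a poor word. -/
def tailWords (n e : ℕ) (a : Bool) (N : ℕ) : Set (List Bool) :=
  {w | w.length = N ∧ ∀ w₁ w₂, w = w₁ ++ (!a) :: w₂ → ∀ c, ¬ Rich n e c w₂}

lemma finite_tailWords (n e : ℕ) (a : Bool) (N : ℕ) : (tailWords n e a N).Finite :=
  (List.finite_length_eq Bool N).subset fun _ h => h.1

/-- Split by the first letter: after `a` the same condition remains, while after `!a` the whole rest
is a poor word. -/
lemma ncard_tailWords_le (n e : ℕ) (a : Bool) (N : ℕ) :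
    (tailWords n e a N).ncard ≤ 1 + ∑ i ∈ Finset.range N, (poorWords n e i).ncard := by
  induction N with
  | zero =>
    have : tailWords n e a 0 ⊆ {[]} := by
      rintro w ⟨h, -⟩
      simpa using h
    simpa using Set.ncard_le_ncard this
  | succ N ih =>
    have hsub : tailWords n e a (N + 1) ⊆
        (List.cons a '' tailWords n e a N) ∪ (List.cons (!a) '' poorWords n e N) := by
      rintro w ⟨hl, hw⟩
      match w, hl, hw with
      | x :: w, hl, hw =>
        have hl' : w.length = N := by simpa using hl
        by_cases hx : x = a
        · subst hx
          refine Or.inl ⟨w, ⟨hl', fun w₁ w₂ h => hw (x :: w₁) w₂ (by simp [h])⟩, rfl⟩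
        · have hx' : x = !a := by cases x <;> cases a <;> simp_all
          subst hx'
          exact Or.inr ⟨w, ⟨hl', hw [] w rfl⟩, rfl⟩
    have h1 := Set.ncard_le_ncard hsub
      (((finite_tailWords n e a N).image _).union ((finite_poorWords n e N).image _))
    have h2 := Set.ncard_union_le (List.cons a '' tailWords n e a N)
      (List.cons (!a) '' poorWords n e N)
    have h3 := Set.ncard_image_le (f := List.cons a) (finite_tailWords n e a N)
    have h4 := Set.ncard_image_le (f := List.cons (!a)) (finite_poorWords n e N)
    rw [Finset.sum_range_succ]
    omega

/-- Some letter `a` occurs `n` times among the first `2 * n` letters and can serve as the first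
block. For the word to be poor, every later `!a` must be followed by a word that is poor one level
down. -/
lemma ncard_poorWords_succ_le (n e N : ℕ) :
    (poorWords n (e + 1) (2 * n + N)).ncard ≤ {w : List Bool | w.length = 2 * n}.ncard *
      (2 * (1 + ∑ i ∈ Finset.range N, (poorWords n e i).ncard)) := by
  set S : Set (List Bool) := {w : List Bool | w.length = 2 * n}
  have hS : S.Finite := List.finite_length_eq Bool _
  set T := tailWords n e true N ∪ tailWords n e false N
  have hT : T.Finite := (finite_tailWords _ _ _ _).union (finite_tailWords _ _ _ _)
  have hsub : poorWords n (e + 1) (2 * n + N) ⊆ (fun q : List Bool × List Bool => q.1 ++ q.2) ''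
      (S ×ˢ T) := by
    rintro w ⟨hl, hw⟩
    refine ⟨(w.take (2 * n), w.drop (2 * n)), ⟨by simp [S, hl], ?_⟩, by simp⟩
    obtain ⟨a, ha⟩ := exists_count_le (n := n) (w := w.take (2 * n)) (by simp [hl])
    have : w.drop (2 * n) ∈ tailWords n e a N := by
      refine ⟨by simp [hl], fun w₁ w₂ h c hc => ?_⟩
      refine hw (fun i => Nat.casesOn i a c) ⟨w.take (2 * n) ++ w₁, w₂, ?_, ?_, hc⟩
      · conv_lhs => rw [← List.take_append_drop (2 * n) w, h]
        simp
      · rw [List.count_append]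
        exact ha.trans (Nat.le_add_right _ _)
    cases a
    · exact Or.inr this
    · exact Or.inl this
  calc _ ≤ _ := Set.ncard_le_ncard hsub ((hS.prod hT).image _)
    _ ≤ (S ×ˢ T).ncard := Set.ncard_image_le (hS.prod hT)
    _ = S.ncard * T.ncard := Set.ncard_prod
    _ ≤ _ := by
      refine Nat.mul_le_mul_left _ ((Set.ncard_union_le _ _).trans ?_)
      have h1 := ncard_tailWords_le n e true N
      have h2 := ncard_tailWords_le n e false N
      omega

/-- There are only `O(N ^ e)` words of length `N` that contain no pattern with `e + 1` mistakes. -/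
theorem exists_ncard_poorWords_le (n e : ℕ) :
    ∃ K, ∀ N, (poorWords n (e + 1) N).ncard ≤ K * (N + 1) ^ e := by
  set C := {w : List Bool | w.length = 2 * n}.ncard
  set D := ∑ i ∈ Finset.range (2 * n), {w : List Bool | w.length = i}.ncard
  have hsmall : ∀ e N, N < 2 * n → (poorWords n e N).ncard ≤ D := by
    intro e N hN
    refine (Set.ncard_le_ncard (fun w h => h.1) (List.finite_length_eq Bool N)).trans ?_
    exact Finset.single_le_sum (f := fun i => {w : List Bool | w.length = i}.ncard)
      (fun _ _ => Nat.zero_le _) (Finset.mem_range.2 hN)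
  -- Each level passes from sums of counts to counts, so the degree grows by one per level. At level
  -- 0 the sums are bounded by `D`, since no poor word has length `2 * n` or more.
  have hstep : ∀ e B, (∀ N, ∑ i ∈ Finset.range N, (poorWords n e i).ncard ≤ B * (N + 1) ^ e) →
      ∀ N, (poorWords n (e + 1) N).ncard ≤ (D + C * (2 * (1 + B))) * (N + 1) ^ e := by
    intro e B hB N
    have h1 : 1 ≤ (N + 1) ^ e := Nat.one_le_pow _ _ (Nat.succ_pos _)
    rcases lt_or_ge N (2 * n) with hN | hN
    · calc _ ≤ D := hsmall _ _ hN
        _ ≤ D + C * (2 * (1 + B)) := Nat.le_add_right _ _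
        _ ≤ _ := Nat.le_mul_of_pos_right _ h1
    · obtain ⟨r, rfl⟩ := Nat.exists_eq_add_of_le hN
      calc _ ≤ C * (2 * (1 + ∑ i ∈ Finset.range r, (poorWords n e i).ncard)) :=
            ncard_poorWords_succ_le n e r
        _ ≤ C * (2 * ((2 * n + r + 1) ^ e + B * (2 * n + r + 1) ^ e)) := by
            have h2 := hB r
            have h3 : B * (r + 1) ^ e ≤ B * (2 * n + r + 1) ^ e := by gcongr; omega
            gcongr
            exact h2.trans h3
        _ = C * (2 * (1 + B)) * (2 * n + r + 1) ^ e := by ring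
        _ ≤ _ := by gcongr; omega
  induction e with
  | zero =>
    refine ⟨_, hstep 0 D fun N => ?_⟩
    rw [pow_zero, mul_one]
    calc ∑ i ∈ Finset.range N, (poorWords n 0 i).ncard
        ≤ ∑ i ∈ Finset.range N ∪ Finset.range (2 * n), (poorWords n 0 i).ncard :=
          Finset.sum_le_sum_of_subset Finset.subset_union_left
      _ = ∑ i ∈ Finset.range (2 * n), (poorWords n 0 i).ncard := by
          symm
          refine Finset.sum_subset Finset.subset_union_right fun i _ hi => ?_
          rw [poorWords_zero (by simpa using hi), Set.ncard_empty]
      _ ≤ _ := Finset.sum_le_sum fun i _ =>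
          Set.ncard_le_ncard (fun w h => h.1) (List.finite_length_eq Bool i)
  | succ e ih =>
    obtain ⟨K, hK⟩ := ih
    refine ⟨_, hstep (e + 1) K fun N => ?_⟩
    calc ∑ i ∈ Finset.range N, (poorWords n (e + 1) i).ncard
        ≤ ∑ i ∈ Finset.range N, K * (N + 1) ^ e := by
          refine Finset.sum_le_sum fun i hi => (hK i).trans ?_
          have := Finset.mem_range.1 hi
          gcongr
      _ = K * (N + 1) ^ e * N := by simp [mul_comm]
      _ ≤ K * (N + 1) ^ e * (N + 1) := by gcongr; omega
      _ = _ := by ring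

/-! ### Realizing ultrafilter limits of types -/

section Limit

open FirstOrder FirstOrder.Language

variable {L : FirstOrder.Language.{u, v}} {M : Type w} [L.Structure M] {κ : Cardinal.{w}}
  {ι : Type*}

/-- The limit type of the new element has only the finitely many entries of `v` as parameters. It is
finitely satisfiable because the existential closure of a finite conjunction holds for almost all `β
i`, hence for `v`. -/
lemma exists_snoc_realize_iff (hκ : ℵ₀ ≤ κ) (hM : IsSaturated L M κ) (U : Ultrafilter ι) {m : ℕ}
    {v : Fin m → M} {β : ι → Fin m → M} (γ : ι → M)
    (hv : ∀ ψ : L.Formula (Fin m), ψ.Realize v ↔ ∀ᶠ i in (U : Filter ι), ψ.Realize (β i)) :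
    ∃ x : M, ∀ ψ : L.Formula (Fin (m + 1)),
      ψ.Realize (Fin.snoc v x : Fin (m + 1) → M) ↔
        ∀ᶠ i in (U : Filter ι), ψ.Realize (Fin.snoc (β i) (γ i) : Fin (m + 1) → M) := by
  classical
  set A : Set M := Set.range v
  have hA : #A < κ := lt_of_lt_of_le (Cardinal.lt_aleph0_of_finite A) hκ
  choose idx hidx using fun a : A => a.2
  set p : Set (L.Formula (A ⊕ Fin 1)) := {ψ | ∀ᶠ i in (U : Filter ι),
    ψ.Realize (Sum.elim (fun a : A => β i (idx a)) (fun _ => γ i))}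
  obtain ⟨y, hy⟩ := hM A hA 1 p (by
    intro p₀ hp₀
    let χ : L.Formula (A ⊕ Fin 1) := Formula.iInf fun ψ : p₀ => ψ.1
    have hχ : ∀ᶠ i in (U : Filter ι),
        χ.Realize (Sum.elim (fun a : A => β i (idx a)) (fun _ => γ i)) := by
      simp only [χ, Formula.realize_iInf, Filter.eventually_all]
      exact fun ψ => hp₀ ψ.2
    let θ : L.Formula (Fin m) :=
      (χ.relabel (Sum.map idx id) : L.Formula (Fin m ⊕ Fin 1)).iExs (Fin 1)
    have hθ : θ.Realize v := by
      rw [hv]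
      filter_upwards [hχ] with i hi
      rw [Formula.realize_iExs]
      refine ⟨fun _ => γ i, ?_⟩
      rw [Formula.realize_relabel]
      convert hi using 1
      ext (a | a) <;> rfl
    rw [Formula.realize_iExs] at hθ
    obtain ⟨y, hy⟩ := hθ
    refine ⟨y, fun ψ hψ => ?_⟩
    rw [Formula.realize_relabel, Formula.realize_iInf] at hy
    convert hy ⟨ψ, hψ⟩ using 1
    ext (a | a)
    · exact (hidx a).symm
    · rfl)
  have key : ∀ ψ : L.Formula (Fin (m + 1)),
      (∀ᶠ i in (U : Filter ι), ψ.Realize (Fin.snoc (β i) (γ i) : Fin (m + 1) → M)) →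
        ψ.Realize (Fin.snoc v (y 0) : Fin (m + 1) → M) := by
    intro ψ hψ
    let g : Fin (m + 1) → A ⊕ Fin 1 :=
      Fin.snoc (α := fun _ => A ⊕ Fin 1) (fun j => Sum.inl ⟨v j, j, rfl⟩) (Sum.inr 0)
    -- Entries of `v` may repeat and `idx` picks just one index for each value; equalities between
    -- entries of `v` hold almost everywhere for `β i`.
    have heq : ∀ᶠ i in (U : Filter ι), ∀ j : Fin m, β i j = β i (idx ⟨v j, j, rfl⟩) := by
      rw [Filter.eventually_all]
      intro j
      have h1 := (hv (Term.equal (Term.var j) (Term.var (idx ⟨v j, j, rfl⟩)))).1 (by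
        rw [Formula.realize_equal]
        exact (hidx ⟨v j, j, rfl⟩).symm)
      filter_upwards [h1] with i hi
      rw [Formula.realize_equal] at hi
      exact hi
    have hmem : ψ.relabel g ∈ p := by
      simp only [p, Set.mem_ofPred_eq]
      filter_upwards [hψ, heq] with i h1 h2
      rw [Formula.realize_relabel]
      convert h1 using 1
      funext j
      refine Fin.lastCases ?_ (fun j => ?_) j
      · simp [g]
      · simp [g, h2 j]
    have h2 := hy _ hmem
    rw [Formula.realize_relabel] at h2
    convert h2 using 1
    funext j
    refine Fin.lastCases ?_ (fun j => ?_) j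
    · simp [g]
    · simp [g]
  refine ⟨y 0, fun ψ => ⟨fun h => ?_, key ψ⟩⟩
  by_contra hc
  rw [← Ultrafilter.eventually_not] at hc
  have := key ψ.not (by simpa only [Formula.realize_not] using hc)
  rw [Formula.realize_not] at this
  exact this h

/-- In an `ℵ₀`-saturated structure, the limit along an ultrafilter of the types of a family of
sequences is realized. -/
theorem exists_realize_iff_eventually (hκ : ℵ₀ ≤ κ) (hM : IsSaturated L M κ) (U : Ultrafilter ι)
    (β : ι → ℕ → M) : ∃ b : ℕ → M, ∀ (m : ℕ) (ψ : L.Formula (Fin m)),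
      ψ.Realize (fun j : Fin m => b j) ↔
        ∀ᶠ i in (U : Filter ι), ψ.Realize (fun j : Fin m => β i j) := by
  let P : (m : ℕ) → (Fin m → M) → Prop := fun m v => ∀ ψ : L.Formula (Fin m),
    ψ.Realize v ↔ ∀ᶠ i in (U : Filter ι), ψ.Realize (fun j : Fin m => β i j)
  have hstep : ∀ (m : ℕ) (v : {v : Fin m → M // P m v}), ∃ x : M,
      P (m + 1) (Fin.snoc v.1 x : Fin (m + 1) → M) := by
    intro m v
    obtain ⟨x, hx⟩ := exists_snoc_realize_iff hκ hM U (fun i => β i m) v.2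
    refine ⟨x, fun ψ => (hx ψ).trans ?_⟩
    refine Filter.eventually_congr (Filter.Eventually.of_forall fun i => ?_)
    rw [show (Fin.snoc (fun j : Fin m => β i j) (β i m) : Fin (m + 1) → M) =
      fun j : Fin (m + 1) => β i j from ?_]
    funext j
    refine Fin.lastCases ?_ (fun j => ?_) j <;> simp
  choose x hx using hstep
  have h0 : P 0 Fin.elim0 := by
    intro ψ
    rw [show (fun i => ψ.Realize (fun j : Fin 0 => β i j)) =
      fun _ => ψ.Realize (Fin.elim0 : Fin 0 → M) from ?_]
    · rw [Filter.eventually_const]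
    · funext i
      rw [Subsingleton.elim (fun j : Fin 0 => β i j) Fin.elim0]
  let s : (m : ℕ) → {v : Fin m → M // P m v} := fun m =>
    Nat.rec ⟨Fin.elim0, h0⟩ (fun m v => ⟨Fin.snoc v.1 (x m v), hx m v⟩) m
  have hs : ∀ m, (s (m + 1)).1 = Fin.snoc (s m).1 (x m (s m)) := fun m => rfl
  refine ⟨fun j => x j (s j), fun m => ?_⟩
  have heq : (s m).1 = fun j : Fin m => x j (s j) := by
    induction m with
    | zero => exact Subsingleton.elim _ _
    | succ m ih =>
      rw [hs, ih]
      funext j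
      refine Fin.lastCases ?_ (fun j => ?_) j <;> simp
  rw [← heq]
  exact (s m).2

theorem exists_tuples_realize_iff_eventually [Nonempty M] (hκ : ℵ₀ ≤ κ) (hM : IsSaturated L M κ)
    (U : Ultrafilter ι) {k : ℕ} (β : ι → ℕ → Fin k → M) : ∃ b : ℕ → Fin k → M,
      ∀ {α : Type} [Finite α] (g : α → ℕ × Fin k) (ψ : L.Formula α),
        ψ.Realize (fun x => b (g x).1 (g x).2) ↔
          ∀ᶠ i in (U : Filter ι), ψ.Realize (fun x => β i (g x).1 (g x).2) := by
  classical
  obtain ⟨b, hb⟩ := exists_realize_iff_eventually hκ hM U fun i t =>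
    -- Sequences of tuples are flattened by pairing; positions that code no coordinate get an
    -- arbitrary value.
    if h : t.unpair.2 < k then β i t.unpair.1 ⟨_, h⟩ else Classical.arbitrary M
  refine ⟨fun j s => b (Nat.pair j s), fun {α} _ g ψ => ?_⟩
  obtain ⟨m, hm⟩ : ∃ m, ∀ x, Nat.pair (g x).1 (g x).2 < m := by
    obtain ⟨m, hm⟩ := (Set.finite_range fun x => Nat.pair (g x).1 (g x).2).bddAbove
    exact ⟨m + 1, fun x => Nat.lt_succ_of_le (hm ⟨x, rfl⟩)⟩
  have h := hb m (ψ.relabel fun x => (⟨_, hm x⟩ : Fin m))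
  simp only [Formula.realize_relabel] at h
  refine h.trans (Filter.eventually_congr (Filter.Eventually.of_forall fun i => ?_))
  rw [show (fun x => β i (g x).1 (g x).2) = _ from ?_]
  funext x
  simp

end Limit

/-! ### Iterated ultrafilters and indiscernible sequences -/

/-- The `n`-fold power of an ultrafilter on `ℕ`. -/
def ultrafilterPow (U : Ultrafilter ℕ) : (n : ℕ) → Ultrafilter (Fin n → ℕ)
  | 0 => pure Fin.elim0
  | n + 1 => U.bind fun i => (ultrafilterPow U n).map (Fin.cons i)

lemma eventually_ultrafilterPow_succ {U : Ultrafilter ℕ} {n : ℕ} {P : (Fin (n + 1) → ℕ) → Prop} :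
    (∀ᶠ v in (ultrafilterPow U (n + 1) : Filter _), P v) ↔
      ∀ᶠ i in (U : Filter ℕ), ∀ᶠ v in (ultrafilterPow U n : Filter _), P (Fin.cons i v) :=
  Iff.rfl

/-- A quantifier over a coordinate that `f` omits is vacuous. Thus all increasing marginals of the
power coincide, which is the source of indiscernibility. -/
lemma eventually_ultrafilterPow_comp {U : Ultrafilter ℕ} {n N : ℕ} {f : Fin n → Fin N}
    (hf : StrictMono f) {P : (Fin n → ℕ) → Prop} :
    (∀ᶠ v in (ultrafilterPow U N : Filter _), P (v ∘ f)) ↔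
      ∀ᶠ v in (ultrafilterPow U n : Filter _), P v := by
  induction N generalizing n with
  | zero =>
    obtain rfl : n = 0 := by
      by_contra hn
      exact (f ⟨0, Nat.pos_of_ne_zero hn⟩).elim0
    refine Filter.eventually_congr (Filter.Eventually.of_forall fun v => ?_)
    rw [Subsingleton.elim (v ∘ f) v]
  | succ N ih =>
    have hlift : ∀ {n : ℕ} (f : Fin n → Fin (N + 1)), StrictMono f → (∀ j, f j ≠ 0) →
        ∃ f' : Fin n → Fin N, StrictMono f' ∧ f = Fin.succ ∘ f' := by
      intro n f hf h0
      refine ⟨fun j => (f j).pred (h0 j), fun i j hij => ?_, ?_⟩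
      · exact Fin.pred_lt_pred_iff.2 (hf hij)
      · funext j; simp
    by_cases h0 : ∀ j, f j ≠ 0
    · obtain ⟨f', hf', rfl⟩ := hlift f hf h0
      rw [eventually_ultrafilterPow_succ, ← ih hf']
      have : ∀ (i : ℕ) (v : Fin N → ℕ), (Fin.cons i v : Fin (N + 1) → ℕ) ∘ (Fin.succ ∘ f') =
          v ∘ f' := fun i v => by funext j; simp
      simp only [this, Filter.eventually_const]
    · push Not at h0
      obtain ⟨j, hj⟩ := h0
      match n, f, hf, j, hj, P with
      | n + 1, f, hf, j, hj, P =>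
        have hf0 : f 0 = 0 := by
          have := hf.monotone (Fin.zero_le j)
          rw [hj] at this
          exact Fin.le_zero_iff.1 this
        obtain ⟨f', hf', hff'⟩ := hlift (f ∘ Fin.succ) (hf.comp (Fin.strictMono_succ))
          (fun j => by
            have := hf (Fin.succ_pos j)
            rw [hf0] at this
            exact this.ne')
        have hcons : ∀ (i : ℕ) (v : Fin N → ℕ), (Fin.cons i v : Fin (N + 1) → ℕ) ∘ f =
            (Fin.cons i (v ∘ f') : Fin (n + 1) → ℕ) := by
          intro i v
          funext j
          refine Fin.cases ?_ (fun j => ?_) j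
          · simp [hf0]
          · have := congrFun hff' j
            simp only [Function.comp_apply] at this ⊢
            simp [this]
        rw [eventually_ultrafilterPow_succ, eventually_ultrafilterPow_succ]
        simp only [hcons]
        exact Filter.eventually_congr (Filter.Eventually.of_forall fun i =>
          ih hf' (P := fun v => P (Fin.cons i v)))

/-- The hyperfilter contains all final segments. The lower bound `m` lets the tail start above the
coordinate already chosen. -/
lemma eventually_strictMono_ultrafilterPow (n m : ℕ) :
    ∀ᶠ v in (ultrafilterPow (Filter.hyperfilter ℕ) n : Filter (Fin n → ℕ)),
      StrictMono v ∧ ∀ j, m < v j := by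
  induction n generalizing m with
  | zero => exact Filter.Eventually.of_forall fun v => ⟨fun i => i.elim0, fun i => i.elim0⟩
  | succ n ih =>
    rw [eventually_ultrafilterPow_succ]
    have h1 : ∀ᶠ i in (Filter.hyperfilter ℕ : Filter ℕ), m < i :=
      Nat.hyperfilter_le_atTop (Filter.eventually_gt_atTop m)
    filter_upwards [h1] with i hi
    filter_upwards [ih i] with v hv
    refine ⟨?_, fun j => ?_⟩
    · rw [Fin.strictMono_iff_lt_succ]
      intro j
      match n, v, hv, j with
      | n + 1, v, hv, j =>
        refine Fin.cases ?_ (fun j => ?_) j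
        · simpa using hv.2 0
        · simpa using hv.1 (Fin.castSucc_lt_succ (i := j))
    · refine Fin.cases ?_ (fun j => ?_) j
      · simpa using hi
      · simpa using hi.trans (hv.2 j)

/-- In an `ℵ₀`-saturated structure, from every sequence of tuples one obtains indiscernible
sequences of any finite length that satisfy all formulas satisfied by the increasing tuples of the
given sequence. -/
theorem exists_isIndiscernible {L : FirstOrder.Language.{u, v}} {M : Type w} [L.Structure M]
    [Nonempty M] {κ : Cardinal.{w}} (hκ : ℵ₀ ≤ κ) (hM : IsSaturated L M κ) {k : ℕ}
    (a : ℕ → Fin k → M) (N : ℕ) : ∃ b : Fin N → Fin k → M, IsIndiscernible L b ∧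
      ∀ ψ : L.Formula (Fin N × Fin k),
        (∀ f : Fin N → ℕ, StrictMono f → ψ.Realize (fun p => a (f p.1) p.2)) →
          ψ.Realize (fun p => b p.1 p.2) := by
  classical
  set V := ultrafilterPow (Filter.hyperfilter ℕ)
  obtain ⟨b, hb⟩ := exists_tuples_realize_iff_eventually hκ hM (V N)
    fun f j => if h : j < N then a (f ⟨j, h⟩) else a 0
  refine ⟨fun i => b i, fun n f g hf hg ψ => ?_, fun ψ hψ => ?_⟩
  -- The truth of `ψ` along `f` is its truth for almost all `v` in the `n`-fold power, whatever `f`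
  -- is.
  · have key : ∀ f : Fin n → Fin N, StrictMono f → (ψ.Realize (fun p => b (f p.1) p.2) ↔
        ∀ᶠ v in (V n : Filter (Fin n → ℕ)), ψ.Realize (fun p => a (v p.1) p.2)) := by
      intro f hf
      have h1 := hb (fun p : Fin n × Fin k => ((f p.1 : ℕ), p.2)) ψ
      have h2 := eventually_ultrafilterPow_comp (U := Filter.hyperfilter ℕ) hf
        (P := fun v => ψ.Realize (fun p => a (v p.1) p.2))
      simp only [Fin.is_lt, dite_true, Fin.eta] at h1
      exact h1.trans h2
    exact (key f hf).trans (key g hg).symm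
  · have h1 := hb (fun p : Fin N × Fin k => ((p.1 : ℕ), p.2)) ψ
    simp only [Fin.is_lt, dite_true, Fin.eta] at h1
    rw [h1]
    filter_upwards [eventually_strictMono_ultrafilterPow N 0] with f hf
    exact hψ f hf.1

/-! ### Types over finite sequences as patterns -/

section Patterns

open FirstOrder FirstOrder.Language

variable {L : FirstOrder.Language.{u, v}} {M : Type w} [L.Structure M] {l k : ℕ}

/-- Some instance of `φ` holds in the sequence `b` exactly at the places marked by `v`. -/
def RealizesPattern (φ : L.Formula (Fin l ⊕ Fin k)) {N : ℕ} (b : Fin N → Fin k → M)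
    (v : Fin N → Bool) : Prop :=
  ∃ x : Fin l → M, ∀ i, φ.Realize (Sum.elim x (b i)) ↔ v i = true

/-- A formula expressing `RealizesPattern`. -/
def patternFormula (φ : L.Formula (Fin l ⊕ Fin k)) {N : ℕ} (v : Fin N → Bool) :
    L.Formula (Fin N × Fin k) :=
  (Formula.iInf fun i : Fin N =>
    let ψ : L.Formula ((Fin N × Fin k) ⊕ Fin l) :=
      φ.relabel (Sum.elim Sum.inr fun s => Sum.inl (i, s))
    if v i then ψ else ψ.not).iExs (Fin l)

lemma realize_patternFormula {φ : L.Formula (Fin l ⊕ Fin k)} {N : ℕ} {v : Fin N → Bool}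
    {b : Fin N → Fin k → M} :
    (patternFormula φ v).Realize (fun p => b p.1 p.2) ↔ RealizesPattern φ b v := by
  rw [patternFormula, Formula.realize_iExs]
  refine exists_congr fun x => ?_
  rw [Formula.realize_iInf]
  refine forall_congr' fun i => ?_
  have h : (Sum.elim (fun p : Fin N × Fin k => b p.1 p.2) x) ∘
      (Sum.elim Sum.inr fun s => Sum.inl (i, s)) = Sum.elim x (b i) := by
    ext (j | j) <;> rfl
  cases hv : v i <;> simp [Formula.realize_not, Formula.realize_relabel, h]

lemma RealizesPattern.comp {φ : L.Formula (Fin l ⊕ Fin k)} {N n : ℕ} {b : Fin N → Fin k → M}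
    {v : Fin N → Bool} (h : RealizesPattern φ b v) (f : Fin n → Fin N) :
    RealizesPattern φ (b ∘ f) (v ∘ f) :=
  let ⟨x, hx⟩ := h
  ⟨x, fun i => hx (f i)⟩

lemma IsIndiscernible.realizesPattern_iff {φ : L.Formula (Fin l ⊕ Fin k)} {N n : ℕ}
    {b : Fin N → Fin k → M} (hb : IsIndiscernible L b) {f g : Fin n → Fin N} (hf : StrictMono f)
    (hg : StrictMono g) (v : Fin n → Bool) :
    RealizesPattern φ (b ∘ f) v ↔ RealizesPattern φ (b ∘ g) v := by
  rw [← realize_patternFormula, ← realize_patternFormula]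
  exact hb n f g hf hg _

lemma realizesPattern_of_mem_phiTypes {φ : L.Formula (Fin l ⊕ Fin k)} {N : ℕ}
    {b : Fin N → Fin k → M} {A B : Set (Fin k → M)} (hb : Set.range b ⊆ A)
    (hB : B ∈ phiTypes φ A) {v : Fin N → Bool} (hv : ∀ i, b i ∈ B ↔ v i = true) :
    RealizesPattern φ b v := by
  classical
  obtain ⟨x, hx⟩ := hB.2 (Finset.univ.image b) (by simpa using hb)
  exact ⟨x, fun i => (hx (b i) (by simp)).trans (hv i)⟩

/-- Repeated terms of `b` do no harm: a realized pattern takes equal values at equal terms. -/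
lemma ncard_phiTypes_range (φ : L.Formula (Fin l ⊕ Fin k)) {N : ℕ} (b : Fin N → Fin k → M) :
    (phiTypes φ (Set.range b)).ncard = {v | RealizesPattern φ b v}.ncard := by
  classical
  refine Set.ncard_congr (fun B _ i => decide (b i ∈ B)) ?_ ?_ ?_
  · intro B hB
    exact realizesPattern_of_mem_phiTypes subset_rfl hB (by simp)
  · intro B B' hB hB' h
    ext y
    by_cases hy : y ∈ Set.range b
    · obtain ⟨i, rfl⟩ := hy
      simpa using congrFun h i
    · exact iff_of_false (fun h => hy (hB.1 h)) (fun h => hy (hB'.1 h))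
  · rintro v ⟨x, hx⟩
    refine ⟨{y | y ∈ Set.range b ∧ φ.Realize (Sum.elim x y)}, ⟨fun y hy => hy.1, ?_⟩, ?_⟩
    · exact fun F hF => ⟨x, fun y hy => ⟨fun h => ⟨hF hy, h⟩, fun h => h.2⟩⟩
    · funext i
      simp [hx]

lemma image_mem_phiTypes {φ : L.Formula (Fin l ⊕ Fin k)} {a : ℕ → Fin k → M}
    (ha : Function.Injective a) {w : ℕ → Bool}
    (hw : ∀ N, RealizesPattern φ (fun i : Fin N => a i) (fun i : Fin N => w i)) :
    a '' {i | w i = true} ∈ phiTypes φ (Set.range a) := by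
  classical
  refine ⟨Set.image_subset_range _ _, fun F hF => ?_⟩
  have hfin : (a ⁻¹' (F : Set (Fin k → M))).Finite := F.finite_toSet.preimage ha.injOn
  obtain ⟨m, hm⟩ := hfin.bddAbove
  obtain ⟨x, hx⟩ := hw (m + 1)
  refine ⟨x, fun y hy => ?_⟩
  obtain ⟨i, rfl⟩ := hF hy
  rw [ha.mem_set_image]
  exact hx ⟨i, Nat.lt_succ_of_le (hm hy)⟩

lemma finite_phiTypes (φ : L.Formula (Fin l ⊕ Fin k)) {A : Set (Fin k → M)} (hA : A.Finite) :
    (phiTypes φ A).Finite :=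
  hA.finite_subsets.subset fun _ h => h.1

lemma mem_phiTypes (φ : L.Formula (Fin l ⊕ Fin k)) (A : Set (Fin k → M)) (x : Fin l → M) :
    {y | y ∈ A ∧ φ.Realize (Sum.elim x y)} ∈ phiTypes φ A :=
  ⟨fun _ h => h.1, fun _ hF => ⟨x, fun _ hy => ⟨fun h => ⟨hF hy, h⟩, fun h => h.2⟩⟩⟩

lemma one_le_ncard_phiTypes [Nonempty M] (φ : L.Formula (Fin l ⊕ Fin k)) {A : Set (Fin k → M)}
    (hA : A.Finite) : 1 ≤ (phiTypes φ A).ncard :=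
  (Set.ncard_pos (finite_phiTypes φ hA)).2
    ⟨_, mem_phiTypes φ A fun _ => Classical.arbitrary M⟩

lemma traceOn_subset_phiTypes {φ : L.Formula (Fin l ⊕ Fin k)} {A F : Set (Fin k → M)}
    {𝒞 : Set (Set (Fin k → M))} (h : Traces φ A 𝒞) (hF : F ⊆ A) : traceOn 𝒞 F ⊆ phiTypes φ F := by
  rintro _ ⟨C, hC, rfl⟩
  refine ⟨Set.inter_subset_right, fun F' hF' => ?_⟩
  obtain ⟨x, hx⟩ := (h hC).2 F' (hF'.trans hF)
  exact ⟨x, fun y hy => (hx y hy).trans ⟨fun h => ⟨h, hF' hy⟩, fun h => h.1⟩⟩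

/-- `φ` traces an infinite `d`-maximum set system. -/
def TracesMaximum (M : Type w) [L.Structure M] (φ : L.Formula (Fin l ⊕ Fin k)) (d : ℕ∞) : Prop :=
  ∃ (A : Set (Fin k → M)) (𝒞 : Set (Set (Fin k → M))),
    A.Infinite ∧ Traces φ A 𝒞 ∧ IsMaximum d A 𝒞

lemma tracesMaximum_of_word {φ : L.Formula (Fin l ⊕ Fin k)} {a : ℕ → Fin k → M}
    (ha : Function.Injective a) (c : ℕ → Bool) {d : ℕ}
    (h : ∀ p, (∀ m, mistakes p m ≤ d) →
      ∀ N, RealizesPattern φ (fun i : Fin N => a i) (fun i : Fin N => word c p i)) :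
    TracesMaximum M φ d := by
  refine ⟨Set.range a, wordSystem c a d, Set.infinite_range_of_injective ha, ?_,
    isMaximum_wordSystem c ha d⟩
  rintro _ ⟨p, hp, rfl⟩
  exact image_mem_phiTypes ha (h p hp)

lemma tracesMaximum_top_of_forall {φ : L.Formula (Fin l ⊕ Fin k)} {a : ℕ → Fin k → M}
    (ha : Function.Injective a)
    (h : ∀ (w : ℕ → Bool) (N : ℕ), RealizesPattern φ (fun i : Fin N => a i) (fun i => w i)) :
    TracesMaximum M φ ⊤ := by
  classical
  refine ⟨Set.range a, 𝒫 (Set.range a), Set.infinite_range_of_injective ha, ?_, fun C hC => hC, ?_⟩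
  · intro C hC
    have := image_mem_phiTypes ha (w := fun i => decide (a i ∈ C)) (h fun i => decide (a i ∈ C))
    convert this
    ext y
    constructor
    · intro hy
      obtain ⟨i, rfl⟩ := hC hy
      exact ⟨i, by simpa using hy, rfl⟩
    · rintro ⟨i, hi, rfl⟩
      simpa using hi
  · intro F hF
    have : traceOn (𝒫 (Set.range a)) (F : Set (Fin k → M)) = 𝒫 (F : Set (Fin k → M)) := by
      ext B
      constructor
      · rintro ⟨C, -, rfl⟩
        exact Set.inter_subset_right
      · intro hB
        exact ⟨B, hB.trans hF, (Set.inter_eq_left.2 hB).symm⟩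
    rw [this, Set.ncard_powerset _ F.finite_toSet, Set.ncard_coe_finset]
    simp [binomLE]

/-- A single set is 0-maximum, and every instance of `φ` defines one. -/
lemma tracesMaximum_zero [Infinite M] (hk : 1 ≤ k) (φ : L.Formula (Fin l ⊕ Fin k)) :
    TracesMaximum M φ (0 : ℕ) := by
  have : Nonempty (Fin k) := ⟨⟨0, hk⟩⟩
  refine ⟨Set.univ, {_}, Set.infinite_univ,
    Set.singleton_subset_iff.2 (mem_phiTypes φ _ fun _ => Classical.arbitrary M),
    fun _ _ => Set.subset_univ _, fun F _ => ?_⟩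
  have h1 : ∀ (C : Set (Fin k → M)) (F : Set (Fin k → M)), traceOn {C} F = {C ∩ F} := by
    intro C F
    ext B
    simp [traceOn]
  rw [h1, Set.ncard_singleton, binomLE]
  split_ifs with h
  · simp
  · have : F.card = 0 := by simpa using h
    simp [this]

variable {κ : Cardinal.{w}}

/-- Saturation yields an infinite sequence whose initial segments realize prescribed patterns as
soon as there are such finite sequences. -/
lemma exists_seq_realizesPattern [Nonempty M] (hκ : ℵ₀ ≤ κ) (hM : IsSaturated L M κ)
    (φ : L.Formula (Fin l ⊕ Fin k)) (W : Set (ℕ → Bool))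
    (h : ∀ N, ∃ b : Fin N → Fin k → M, ∀ w ∈ W, RealizesPattern φ b (fun i => w i)) :
    ∃ a : ℕ → Fin k → M, ∀ w ∈ W, ∀ N,
      RealizesPattern φ (fun i : Fin N => a i) (fun i : Fin N => w i) := by
  choose b hb using h
  obtain ⟨a, ha⟩ := exists_tuples_realize_iff_eventually hκ hM (Filter.hyperfilter ℕ)
    fun n j => if h : j < n then b n ⟨j, h⟩ else fun _ => Classical.arbitrary M
  refine ⟨a, fun w hw N => ?_⟩
  rw [← realize_patternFormula]
  refine (ha (fun p : Fin N × Fin k => ((p.1 : ℕ), p.2)) _).2 ?_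
  have h1 : ∀ᶠ n in (Filter.hyperfilter ℕ : Filter ℕ), N ≤ n :=
    Nat.hyperfilter_le_atTop (Filter.eventually_ge_atTop N)
  filter_upwards [h1] with n hn
  have h2 := (hb n w hw).comp (Fin.castLE hn)
  rw [← realize_patternFormula] at h2
  convert h2 using 1
  · rfl
  · funext p
    have : (p.1 : ℕ) < n := p.1.2.trans_le hn
    simp only [this, dite_true]
    rfl

lemma injective_of_realizesPattern {φ : L.Formula (Fin l ⊕ Fin k)} {a : ℕ → Fin k → M}
    (h : ∀ i j, i < j → ∃ w : ℕ → Bool, w i ≠ w j ∧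
      ∀ N, RealizesPattern φ (fun i : Fin N => a i) (fun i : Fin N => w i)) :
    Function.Injective a := by
  have key : ∀ i j, i < j → a i ≠ a j := by
    intro i j hij heq
    obtain ⟨w, hw, hN⟩ := h i j hij
    obtain ⟨x, hx⟩ := hN (j + 1)
    have h1 := hx ⟨i, by omega⟩
    have h2 := hx ⟨j, by omega⟩
    simp only at h1 h2
    rw [heq, h2] at h1
    exact hw (Bool.eq_iff_iff.2 h1.symm)
  intro i j hij
  rcases lt_trichotomy i j with h1 | h1 | h1
  · exact (key i j h1 hij).elim
  · exact h1
  · exact (key j i h1 hij.symm).elim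

/-- An `N`-maximum system shatters every `N` points of its ground set; saturation glues these finite
shattered sets into an infinite one. -/
lemma tracesMaximum_top [Nonempty M] (hκ : ℵ₀ ≤ κ) (hM : IsSaturated L M κ)
    {φ : L.Formula (Fin l ⊕ Fin k)} (h : ∀ d : ℕ, TracesMaximum M φ d) : TracesMaximum M φ ⊤ := by
  classical
  obtain ⟨a, ha⟩ := exists_seq_realizesPattern hκ hM φ Set.univ (by
    intro N
    obtain ⟨A, 𝒞, hA, hT, hmax⟩ := h N
    obtain ⟨F, hFA, hF⟩ := hA.exists_subset_card_eq N
    let b : Fin N → Fin k → M := fun i => (F.equivFinOfCardEq hF).symm i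
    have hbinj : Function.Injective b :=
      Subtype.val_injective.comp (F.equivFinOfCardEq hF).symm.injective
    have hbF : ∀ i, b i ∈ F := fun i => ((F.equivFinOfCardEq hF).symm i).2
    refine ⟨b, fun w _ => ?_⟩
    have h1 : traceOn 𝒞 (F : Set (Fin k → M)) = 𝒫 (F : Set (Fin k → M)) := by
      refine Set.eq_of_subset_of_ncard_le ?_ ?_ F.finite_toSet.finite_subsets
      · rintro _ ⟨C, -, rfl⟩
        exact Set.inter_subset_right
      · rw [Set.ncard_powerset _ F.finite_toSet, Set.ncard_coe_finset, hmax.2 F hFA, hF]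
        simp [binomLE]
    have h2 : b '' {i | w i = true} ∈ phiTypes φ (F : Set (Fin k → M)) := by
      refine traceOn_subset_phiTypes hT hFA ?_
      rw [h1]
      rintro _ ⟨i, -, rfl⟩
      exact hbF i
    refine realizesPattern_of_mem_phiTypes (by rintro _ ⟨i, rfl⟩; exact hbF i) h2 fun i => ?_
    rw [hbinj.mem_set_image]
    rfl)
  refine tracesMaximum_top_of_forall (injective_of_realizesPattern (φ := φ) fun i j hij => ?_)
    fun w => ha w trivial
  exact ⟨fun t => decide (t = i), by simp [hij.ne'], ha (fun t => decide (t = i)) trivial⟩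

lemma exists_isIndiscernible_binomLE_le [Nonempty M] (hκ : ℵ₀ ≤ κ) (hM : IsSaturated L M κ)
    {φ : L.Formula (Fin l ⊕ Fin k)} {d : ℕ∞} (h : TracesMaximum M φ d) (N : ℕ) :
    ∃ b : Fin N → Fin k → M, IsIndiscernible L b ∧
      binomLE N d ≤ (phiTypes φ (Set.range b)).ncard := by
  classical
  obtain ⟨A, 𝒞, hA, hT, hmax⟩ := h
  let a : ℕ → Fin k → M := fun i => hA.natEmbedding A i
  have ha : Function.Injective a := Subtype.val_injective.comp (hA.natEmbedding A).injective
  have haA : ∀ i, a i ∈ A := fun i => (hA.natEmbedding A i).2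
  obtain ⟨b, hb, hba⟩ := exists_isIndiscernible hκ hM a N
  refine ⟨b, hb, ?_⟩
  let S : Set (Fin N → Bool) := {v | RealizesPattern φ b v}
  let ψ : L.Formula (Fin N × Fin k) :=
    Formula.iInf fun v : (Sᶜ : Set (Fin N → Bool)) => (patternFormula φ v.1).not
  have hψ : ψ.Realize (fun p => b p.1 p.2) := by
    simp only [ψ, Formula.realize_iInf, Formula.realize_not]
    intro v hv
    exact v.2 (realize_patternFormula.1 hv)
  -- The formula `ψ` says that only patterns in `S` are realized. Were it false on all increasing
  -- tuples of `a`, its negation would hold for `b`. So some subsequence of `a` realizes no more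
  -- patterns than `b`.
  obtain ⟨f, hf, hfψ⟩ : ∃ f : Fin N → ℕ, StrictMono f ∧ ψ.Realize (fun p => a (f p.1) p.2) := by
    by_contra! hc
    have := hba ψ.not fun f hf => Formula.realize_not.2 (hc f hf)
    exact Formula.realize_not.1 this hψ
  have hsub : {v | RealizesPattern φ (a ∘ f) v} ⊆ S := by
    intro v hv
    by_contra hvS
    simp only [ψ, Formula.realize_iInf, Formula.realize_not] at hfψ
    exact hfψ ⟨v, hvS⟩ (realize_patternFormula.2 hv)
  rw [ncard_phiTypes_range]
  refine le_trans ?_ (Set.ncard_le_ncard hsub)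
  rw [← ncard_phiTypes_range]
  have hrange : Set.range (a ∘ f) = ((Finset.univ.image (a ∘ f) : Finset _) : Set (Fin k → M)) := by
    rw [Finset.coe_image, Finset.coe_univ, Set.image_univ]
  have hFA : ((Finset.univ.image (a ∘ f) : Finset _) : Set (Fin k → M)) ⊆ A := by
    rw [← hrange]
    rintro _ ⟨i, rfl⟩
    exact haA _
  have hcard : (Finset.univ.image (a ∘ f)).card = N := by
    rw [Finset.card_image_of_injective _ (ha.comp hf.injective), Finset.card_univ, Fintype.card_fin]
  have h1 := hmax.2 _ hFA
  rw [hcard] at h1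
  rw [← h1, hrange]
  exact Set.ncard_le_ncard (traceOn_subset_phiTypes hT hFA)
    (finite_phiTypes φ (Finset.finite_toSet _))

end Patterns

/-! ### Densities -/

section Density

open FirstOrder FirstOrder.Language

variable {L : FirstOrder.Language.{u, v}} {M : Type w} [L.Structure M] {l k : ℕ}
  {κ : Cardinal.{w}}

/-- If `φ` traces no infinite `(d+1)`-maximum system, then there are `O(N ^ d)` many `φ`-types over
indiscernible sequences of length `N`. -/
theorem vcIndDensityBound_of_not_tracesMaximum [Nonempty M] (hκ : ℵ₀ ≤ κ)
    (hM : IsSaturated L M κ) {φ : L.Formula (Fin l ⊕ Fin k)} {d : ℕ}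
    (h : ¬ TracesMaximum M φ (d + 1 : ℕ)) : VCIndDensityBound M φ d := by
  classical
  by_contra hbound
  apply h
  -- With at most `d + 1` mistakes only the letters `c 0, …, c (d + 1)` are consulted; truncating
  -- leaves finitely many candidates for `c`.
  let ext : (Fin (d + 2) → Bool) → ℕ → Bool := fun c j =>
    if hj : j < d + 2 then c ⟨j, hj⟩ else false
  let W : (Fin (d + 2) → Bool) → Set (ℕ → Bool) := fun c =>
    {w | ∃ p, (∀ m, mistakes p m ≤ d + 1) ∧ w = word (ext c) p}
  have hfin : ∀ n, ∃ c, ∃ b : Fin n → Fin k → M, ∀ w ∈ W c, RealizesPattern φ b (fun i => w i) := by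
    intro n
    obtain ⟨K, hK⟩ := exists_ncard_poorWords_le n d
    simp only [VCIndDensityBound, not_exists, not_forall, not_lt] at hbound
    -- The factor `2 ^ d` turns `(N + 1) ^ d` into `N ^ d`, and `+ 1` makes the patterns outnumber
    -- the poor words.
    obtain ⟨N, hN, b, hb, hcard⟩ := hbound (K * 2 ^ d + 1)
    rw [Real.rpow_natCast, ncard_phiTypes_range] at hcard
    have hcard' : (K * 2 ^ d + 1) * N ^ d ≤ {v | RealizesPattern φ b v}.ncard := by
      exact_mod_cast hcard
    obtain ⟨v, hv, c, hc⟩ : ∃ v, RealizesPattern φ b v ∧ ∃ c, Rich n (d + 1) c (List.ofFn v) := by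
      by_contra! hcon
      have h1 : {v | RealizesPattern φ b v}.ncard ≤ (poorWords n (d + 1) N).ncard :=
        Set.ncard_le_ncard_of_injOn List.ofFn (fun v hv => ⟨by simp, hcon v hv⟩)
          (fun v _ v' _ h => List.ofFn_injective h) (finite_poorWords _ _ _)
      have h2 := hK N
      have h3 : (N + 1) ^ d ≤ (2 * N) ^ d := Nat.pow_le_pow_left (by omega) _
      have h4 : 1 ≤ N ^ d := Nat.one_le_pow _ _ hN
      have h5 : K * (N + 1) ^ d ≤ K * 2 ^ d * N ^ d := by
        calc K * (N + 1) ^ d ≤ K * (2 * N) ^ d := Nat.mul_le_mul_left _ h3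
          _ = _ := by rw [mul_pow, mul_assoc]
      rw [add_mul] at hcard'
      omega
    have hsub : ∀ p, (∀ m, mistakes p m ≤ d + 1) → ∃ f : Fin n → Fin N, StrictMono f ∧
        v ∘ f = fun i : Fin n => word c p i := by
      intro p hp
      obtain ⟨g, hg⟩ := List.sublist_iff_exists_orderEmbedding_getElem?_eq.1
        (hc.sublist le_rfl (hp n))
      have hg' : ∀ i, i < n → ∃ hi : g i < N, v ⟨g i, hi⟩ = word c p i := by
        intro i hi
        have h1 := hg i
        rw [List.getElem?_map, List.getElem?_range hi] at h1
        have h2 := (List.getElem?_eq_some_iff.1 h1.symm)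
        obtain ⟨h3, h4⟩ := h2
        exact ⟨by simpa using h3, by simpa using h4⟩
      refine ⟨fun i => ⟨g i, (hg' i i.2).1⟩, fun i j hij => ?_, ?_⟩
      · exact g.strictMono hij
      · funext i
        exact (hg' i i.2).2
    have hn : n ≤ N := by
      obtain ⟨f, hf, -⟩ := hsub (fun _ => false) (fun m => by simp [mistakes_eq_card])
      simpa using Fintype.card_le_of_injective f hf.injective
    refine ⟨fun j => c j, b ∘ Fin.castLE hn, ?_⟩
    rintro _ ⟨p, hp, rfl⟩
    obtain ⟨f, hf, hvf⟩ := hsub p hp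
    have hcc : word (ext fun j => c j) p = word c p := by
      refine word_congr hp fun j hj => ?_
      simp only [ext]
      rw [dif_pos (by omega)]
    rw [hcc, ← hvf]
    -- Each subword lives on its own subsequence of `b`; indiscernibility moves all of them to the
    -- first `n` terms.
    exact (hb.realizesPattern_iff hf (Fin.strictMono_castLE hn) _).1 (hv.comp f)
  -- Pigeonhole: if every `c` failed at some length, none would work at the largest of these
  -- lengths.
  obtain ⟨c, hc⟩ : ∃ c, ∀ n, ∃ b : Fin n → Fin k → M, ∀ w ∈ W c,
      RealizesPattern φ b (fun i => w i) := by
    by_contra! hcon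
    choose n hn using hcon
    obtain ⟨c, b, hb⟩ := hfin (Finset.univ.sup n)
    have hle : n c ≤ Finset.univ.sup n := Finset.le_sup (Finset.mem_univ c)
    obtain ⟨w, hw, hnot⟩ := hn c (b ∘ Fin.castLE hle)
    exact hnot ((hb w hw).comp (Fin.castLE hle))
  obtain ⟨a, ha⟩ := exists_seq_realizesPattern hκ hM φ (W c) hc
  refine tracesMaximum_of_word (injective_of_realizesPattern (φ := φ) fun i j hij => ?_) (ext c)
    fun p hp => ha _ ⟨p, hp, rfl⟩
  -- A single mistake at `j` gives the letters `c 0` at `i` and its negation at `j`, so these terms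
  -- differ.
  obtain ⟨q, hq⟩ : ∃ q : ℕ → Bool, q = indicator {j} := ⟨_, rfl⟩
  have hq1 : ∀ m, mistakes q m ≤ 1 := by
    intro m
    rw [hq]
    exact (mistakes_indicator_le _ m).trans (by simp)
  have hq0 : ∀ m ≤ j, mistakes q m = 0 := by
    intro m hm
    rw [hq, mistakes_indicator, Finset.card_eq_zero, Finset.filter_eq_empty_iff]
    simp only [Finset.mem_singleton]
    omega
  refine ⟨word (ext c) q, ?_, ha _ ⟨q, fun m => (hq1 m).trans (by omega), rfl⟩⟩
  have hqi : q i = false := by simp [hq, indicator, hij.ne]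
  have hqj : q j = true := by simp [hq, indicator]
  simp [word, hq0 i hij.le, hq0 j le_rfl, hqi, hqj]

/-- For large `N`, `N.choose e` is at least `(N / 2) ^ e / e!`, which outgrows every `K * N ^ r`
with `r < e`. -/
lemma le_of_choose_lt {e K : ℕ} {r : ℝ}
    (h : ∀ N : ℕ, 1 ≤ N → (N.choose e : ℝ) < K * (N : ℝ) ^ r) : (e : ℝ) ≤ r := by
  by_contra! hr
  have hpos : 0 < (e : ℝ) - r := sub_pos.2 hr
  have ht := (tendsto_rpow_atTop hpos).comp (tendsto_natCast_atTop_atTop (R := ℝ))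
  obtain ⟨N, hN1, hN2⟩ := ((ht.eventually_ge_atTop ((K : ℝ) * 2 ^ e * (e.factorial : ℝ))).and
    (Filter.eventually_ge_atTop (2 * e + 1))).exists
  have hN0 : (0 : ℝ) < N := by
    have : 0 < N := by omega
    exact_mod_cast this
  have h1 := Nat.pow_le_choose (α := ℝ) e N
  have h2 := h N (by omega)
  have h3 : (N : ℝ) / 2 ≤ ((N + 1 - e : ℕ) : ℝ) := by
    rw [div_le_iff₀ two_pos]
    have : N ≤ (N + 1 - e) * 2 := by omega
    exact_mod_cast this
  have h4 : ((N : ℝ) / 2) ^ e ≤ ((N + 1 - e : ℕ) : ℝ) ^ e := pow_le_pow_left₀ (by positivity) h3 e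
  have hf : (0 : ℝ) < e.factorial := by exact_mod_cast e.factorial_pos
  have h5 : ((N : ℝ) / 2) ^ e < K * (N : ℝ) ^ r * e.factorial := by
    rw [← div_lt_iff₀ hf]
    refine lt_of_le_of_lt ?_ h2
    refine le_trans ?_ h1
    gcongr
  have h6 : ((N : ℝ) / 2) ^ e = (N : ℝ) ^ ((e : ℝ) - r) * (N : ℝ) ^ r / 2 ^ e := by
    rw [← Real.rpow_add hN0, sub_add_cancel, Real.rpow_natCast, div_pow]
  rw [h6, div_lt_iff₀ (by positivity)] at h5
  have h7 : (0 : ℝ) < (N : ℝ) ^ r := Real.rpow_pos_of_pos hN0 r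
  have h8 : (N : ℝ) ^ ((e : ℝ) - r) * (N : ℝ) ^ r < (K * 2 ^ e * e.factorial) * (N : ℝ) ^ r := by
    calc _ < _ := h5
      _ = _ := by ring
  have h9 := lt_of_mul_lt_mul_right h8 h7.le
  exact absurd hN1 (not_le.2 h9)

/-- If `φ` traces an infinite `d`-maximum system, then `VCdInd φ` is at least every `e ≤ d`. -/
theorem le_vcdInd_of_tracesMaximum [Nonempty M] (hκ : ℵ₀ ≤ κ) (hM : IsSaturated L M κ)
    {φ : L.Formula (Fin l ⊕ Fin k)} {d : ℕ∞} (h : TracesMaximum M φ d) {e : ℕ}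
    (he : ∀ N : ℕ, N.choose e ≤ binomLE N d) : (e : EReal) ≤ VCdInd M φ := by
  refine le_sInf ?_
  rintro _ ⟨r, ⟨K, hK⟩, rfl⟩
  have : (e : ℝ) ≤ r := by
    refine le_of_choose_lt (K := K) fun N hN => ?_
    obtain ⟨b, hb, hcard⟩ := exists_isIndiscernible_binomLE_le hκ hM h N
    refine lt_of_le_of_lt ?_ (hK N hN b hb)
    exact_mod_cast (he N).trans hcard
  simpa using EReal.coe_le_coe_iff.2 this

lemma VCDensityBound.vcIndDensityBound [Infinite M] (hk : 1 ≤ k) {φ : L.Formula (Fin l ⊕ Fin k)}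
    {r : ℝ} (h : VCDensityBound M φ r) : VCIndDensityBound M φ r := by
  classical
  have : Nonempty (Fin k) := ⟨⟨0, hk⟩⟩
  obtain ⟨K, hK⟩ := h
  -- An indiscernible sequence may have fewer than `N` distinct terms, so monotonicity of the power
  -- is needed. Since there is always at least one type, `r` cannot be negative.
  have hr : ((0 : ℕ) : ℝ) ≤ r := by
    refine le_of_choose_lt (K := K) fun N hN => ?_
    obtain ⟨A, hA⟩ := Infinite.exists_subset_card_eq (Fin k → M) N
    refine lt_of_le_of_lt ?_ (hA ▸ hK A (Finset.card_pos.1 (by omega)))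
    simpa using one_le_ncard_phiTypes φ A.finite_toSet
  rw [Nat.cast_zero] at hr
  refine ⟨K, fun N hN b _ => ?_⟩
  have : Nonempty (Fin N) := ⟨⟨0, hN⟩⟩
  have h1 := hK (Finset.univ.image b) (Finset.univ_nonempty.image b)
  rw [Finset.coe_image, Finset.coe_univ, Set.image_univ] at h1
  refine h1.trans_le (mul_le_mul_of_nonneg_left ?_ (Nat.cast_nonneg K))
  refine Real.rpow_le_rpow (Nat.cast_nonneg _) ?_ hr
  have := Finset.card_image_le (s := Finset.univ) (f := b)
  rw [Finset.card_univ, Fintype.card_fin] at this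
  exact_mod_cast this

lemma vcdInd_le_vcd [Infinite M] (hk : 1 ≤ k) (φ : L.Formula (Fin l ⊕ Fin k)) :
    VCdInd M φ ≤ VCd M φ :=
  sInf_le_sInf (Set.image_mono fun _ h => VCDensityBound.vcIndDensityBound hk h)

lemma coe_natCast_eq (n : ℕ) : (((n : ℕ∞) : ENNReal) : EReal) = (n : EReal) := by
  rw [ENat.toENNReal_coe]
  rfl

lemma coe_le_vcdInd_of_tracesMaximum [Nonempty M] (hκ : ℵ₀ ≤ κ) (hM : IsSaturated L M κ)
    {φ : L.Formula (Fin l ⊕ Fin k)} {d : ℕ∞} (h : TracesMaximum M φ d) :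
    ((d : ENNReal) : EReal) ≤ VCdInd M φ := by
  cases d using ENat.recTopCoe with
  | top =>
    have : VCdInd M φ = ⊤ := by
      rw [EReal.eq_top_iff_forall_lt]
      intro r
      obtain ⟨n, hn⟩ := exists_nat_gt r
      have h1 : (n : EReal) ≤ VCdInd M φ :=
        le_vcdInd_of_tracesMaximum hκ hM h fun N => by simpa [binomLE] using N.choose_le_two_pow n
      refine lt_of_lt_of_le ?_ h1
      exact_mod_cast hn
    rw [this]
    exact le_top
  | coe n =>
    rw [coe_natCast_eq]
    exact le_vcdInd_of_tracesMaximum hκ hM h fun N => choose_le_binomLE N n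

/-- The characterization of `VCd φ = VCdInd φ`. -/
theorem vcd_eq_vcdInd_iff [Infinite M] (hκ : ℵ₀ ≤ κ) (hM : IsSaturated L M κ) (hk : 1 ≤ k)
    (φ : L.Formula (Fin l ⊕ Fin k)) : VCd M φ = VCdInd M φ ↔
      ∃ d : ℕ∞, VCd M φ = ((d : ENNReal) : EReal) ∧ TracesMaximum M φ d := by
  classical
  constructor
  · intro heq
    by_cases hall : ∀ d : ℕ, TracesMaximum M φ d
    · have htop := tracesMaximum_top hκ hM hall
      refine ⟨⊤, le_antisymm le_top ?_, htop⟩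
      rw [heq]
      exact coe_le_vcdInd_of_tracesMaximum hκ hM htop
    · push Not at hall
      -- At the least untraced value, its predecessor gives the lower bound and its failure the
      -- matching upper bound.
      have h1 := Nat.find_spec hall
      have h2 : ∀ e < Nat.find hall, TracesMaximum M φ e := fun e he => by
        simpa using Nat.find_min hall he
      generalize Nat.find hall = d at h1 h2
      cases d with
      | zero => exact (h1 (tracesMaximum_zero hk φ)).elim
      | succ d =>
        have hd := h2 d (Nat.lt_succ_self d)
        refine ⟨d, ?_, hd⟩
        rw [heq]
        refine le_antisymm ?_ (coe_le_vcdInd_of_tracesMaximum hκ hM hd)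
        refine sInf_le ⟨d, vcIndDensityBound_of_not_tracesMaximum hκ hM h1, ?_⟩
        rw [coe_natCast_eq]
        rfl
  · rintro ⟨d, hd, hT⟩
    refine le_antisymm ?_ (vcdInd_le_vcd hk φ)
    rw [hd]
    exact coe_le_vcdInd_of_tracesMaximum hκ hM hT

end Density

/-! ### Polynomial inequalities over ordered fields -/

section Polynomial

variable {M : Type w} [Field M] [LinearOrder M] [IsStrictOrderedRing M]

/-- More than `d` affine functionals on `M ^ d` do not realize all sign patterns. -/
lemma exists_set_not_sign_pattern {ι : Type*} [Fintype ι] {d : ℕ} (hd : d < Fintype.card ι)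
    (u₀ : ι → M) (u : ι → Fin d → M) :
    ∃ s : Set ι, ∀ x : Fin d → M, ¬ ∀ j, 0 ≤ u₀ j + ∑ i, x i * u j i ↔ j ∈ s := by
  have hli : ¬ LinearIndependent M u := by
    intro h
    have := h.fintype_card_le_finrank
    rw [Module.finrank_fin_fun] at this
    omega
  obtain ⟨g, hg, j₀, hj₀⟩ : ∃ g : ι → M, ∑ j, g j • u j = 0 ∧ ∃ j, 0 < g j := by
    obtain ⟨g, hg, j, hj⟩ := Fintype.not_linearIndependent_iff.1 hli
    rcases lt_or_gt_of_ne hj with h | h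
    · exact ⟨-g, by simp [hg], j, by simpa using h⟩
    · exact ⟨g, hg, j, h⟩
  have hsum : ∀ x : Fin d → M,
      ∑ j, g j * (u₀ j + ∑ i, x i * u j i) = ∑ j, g j * u₀ j := by
    intro x
    have h0 : ∑ j, g j * ∑ i, x i * u j i = 0 := by
      calc ∑ j, g j * ∑ i, x i * u j i = ∑ i, x i * (∑ j, g j • u j) i := by
            simp only [Finset.mul_sum, Finset.sum_apply, Pi.smul_apply, smul_eq_mul]
            rw [Finset.sum_comm]
            exact Finset.sum_congr rfl fun i _ => Finset.sum_congr rfl fun j _ => by ring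
        _ = 0 := by rw [hg]; simp
    simp only [mul_add, Finset.sum_add_distrib, h0, add_zero]
  -- The sum weighted by `g` does not depend on `x`. The excluded pattern forces on it the sign
  -- opposite to that of its constant value; `0 < g j₀` supplies strictness in the first case.
  rcases le_or_gt 0 (∑ j, g j * u₀ j) with hμ | hμ
  · refine ⟨{j | g j ≤ 0}, fun x hx => ?_⟩
    rw [← hsum x] at hμ
    refine absurd hμ (not_le.2 (Finset.sum_neg' (fun j _ => ?_) ⟨j₀, Finset.mem_univ _, ?_⟩))
    · rcases le_or_gt (g j) 0 with h | h
      · exact mul_nonpos_of_nonpos_of_nonneg h ((hx j).2 h)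
      · exact (mul_neg_of_pos_of_neg h (not_le.1 fun h' => absurd ((hx j).1 h') (not_le.2 h))).le
    · exact mul_neg_of_pos_of_neg hj₀ (not_le.1 fun h' => absurd ((hx j₀).1 h') (not_le.2 hj₀))
  · refine ⟨{j | 0 ≤ g j}, fun x hx => ?_⟩
    rw [← hsum x] at hμ
    refine absurd hμ (not_lt.2 (Finset.sum_nonneg fun j _ => ?_))
    rcases le_or_gt 0 (g j) with h | h
    · exact mul_nonneg h ((hx j).2 h)
    · exact mul_nonneg_of_nonpos_of_nonpos h.le
        (not_le.1 fun h' => absurd ((hx j).1 h') (not_le.2 h)).le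

open Finset in
lemma sum_choose_lt {n d v : ℕ} (hn : 1 ≤ n) (hv : v ≤ d) :
    ∑ i ∈ Iic v, n.choose i < (d + 2) * n ^ d := by
  have h1 : ∑ i ∈ Iic v, n.choose i ≤ ∑ _i ∈ Iic v, n ^ d :=
    sum_le_sum fun i hi => (Nat.choose_le_pow n i).trans
      (Nat.pow_le_pow_right hn ((mem_Iic.1 hi).trans hv))
  rw [sum_const, Nat.card_Iic, smul_eq_mul] at h1
  have h2 : 1 ≤ n ^ d := Nat.one_le_pow _ _ hn
  nlinarith

theorem vcDensityBound_of_polyValue {L : FirstOrder.Language.{u, v}} [L.Structure M] {d k : ℕ}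
    {e : Fin (d + 1) → Fin k → ℕ} {φ : L.Formula (Fin d ⊕ Fin k)}
    (hφ : ∀ (c : Fin d → M) (a : Fin k → M), φ.Realize (Sum.elim c a) ↔ 0 ≤ polyValue e c a) :
    VCDensityBound M φ d := by
  classical
  refine ⟨d + 2, fun A hA => ?_⟩
  let 𝒜 : Finset (Finset A) := Finset.univ.filter fun s =>
    ∃ x : Fin d → M, ∀ a : A, φ.Realize (Sum.elim x a) ↔ a ∈ s
  have h1 : (phiTypes φ (A : Set (Fin k → M))).ncard ≤ 𝒜.card := by
    rw [← Set.ncard_coe_finset]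
    refine Set.ncard_le_ncard_of_injOn (fun B => Finset.univ.filter fun a : A => a.1 ∈ B) ?_ ?_
      (Finset.finite_toSet _)
    · intro B hB
      obtain ⟨x, hx⟩ := hB.2 A subset_rfl
      simp only [𝒜, Finset.coe_filter, Finset.mem_univ, true_and, Set.mem_ofPred_eq,
        Finset.mem_filter]
      exact ⟨x, fun a => hx a a.2⟩
    · intro B hB B' hB' h
      ext y
      by_cases hy : y ∈ A
      · have := Finset.ext_iff.1 h ⟨y, hy⟩
        simpa using this
      · exact iff_of_false (fun h => hy (hB.1 h)) (fun h => hy (hB'.1 h))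
  have h2 : 𝒜.vcDim ≤ d := by
    refine Finset.sup_le fun s hs => ?_
    rw [Finset.mem_shatterer] at hs
    by_contra! hcard
    obtain ⟨t, ht⟩ := exists_set_not_sign_pattern (ι := s) (by simpa using hcard)
      (fun a => ∏ j, a.1.1 j ^ e 0 j) (fun a i => ∏ j, a.1.1 j ^ e i.succ j)
    obtain ⟨B, hB, hBt⟩ := hs (t := s.filter fun a => ∃ h : a ∈ s, (⟨a, h⟩ : s) ∈ t)
      (Finset.filter_subset _ _)
    obtain ⟨x, hx⟩ := (Finset.mem_filter.1 hB).2
    refine ht x fun a => ?_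
    have h3 := (hφ x a.1.1).symm.trans (hx a.1)
    rw [polyValue] at h3
    rw [h3]
    have h4 := Finset.ext_iff.1 hBt a.1
    simp only [Finset.mem_inter, a.2, true_and, Finset.mem_filter, exists_true_left,
      Subtype.coe_eta] at h4
    exact h4
  have h3 := (h1.trans 𝒜.card_le_card_shatterer).trans Finset.card_shatterer_le_sum_vcDim
  rw [Fintype.card_coe] at h3
  have h4 := h3.trans_lt (sum_choose_lt (Finset.card_pos.2 hA) h2)
  rw [Real.rpow_natCast]
  exact_mod_cast h4

/-- With ratio 3, the terms on either side of `T r` add up to less than half of it. -/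
lemma sign_sum_of_dominant {T : ℕ → M} {d r : ℕ} (hr : r ≤ d) (hT : ∀ i, 0 < T i)
    (h₁ : ∀ i < r, 3 * T i ≤ T (i + 1)) (h₂ : ∀ i, r ≤ i → i < d → 3 * T (i + 1) ≤ T i) :
    0 < (-1) ^ r * ∑ i ∈ Finset.range (d + 1), (-1) ^ i * T i := by
  obtain ⟨s, rfl⟩ := Nat.exists_eq_add_of_le hr
  have hlow : ∀ j ≤ r, 2 * ∑ i ∈ Finset.range j, T i < T j := by
    intro j
    induction j with
    | zero => intro _; simpa using hT 0
    | succ j ih =>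
      intro hj
      rw [Finset.sum_range_succ]
      linarith [ih (by omega), h₁ j (by omega)]
  have hhigh : ∀ j ≤ s, 2 * ∑ i ∈ Finset.range j, T (r + 1 + i) ≤ T r - T (r + j) := by
    intro j
    induction j with
    | zero => intro _; simp
    | succ j ih =>
      intro hj
      rw [Finset.sum_range_succ]
      have h3 := h₂ (r + j) (by omega) (by omega)
      rw [show r + 1 + j = r + j + 1 by ring, show r + (j + 1) = r + j + 1 by ring]
      linarith [ih (by omega)]
  have habs : ∀ (F : Finset ℕ) (p : ℕ → ℕ) (S : ℕ → M), (∀ i, 0 < S i) →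
      |∑ i ∈ F, (-1) ^ p i * S i| ≤ ∑ i ∈ F, S i := by
    intro F p S hS
    refine (Finset.abs_sum_le_sum_abs _ _).trans (Finset.sum_le_sum fun i _ => ?_)
    rw [abs_mul, abs_pow, abs_neg, abs_one, one_pow, one_mul, abs_of_pos (hS i)]
  have ha := habs (Finset.range r) (fun i => i) T hT
  have hb := habs (Finset.range s) (fun i => r + 1 + i) (fun i => T (r + 1 + i)) fun i => hT _
  rw [show r + s + 1 = r + 1 + s by ring, Finset.sum_range_add, Finset.sum_range_succ]
  have hlow' := hlow r le_rfl
  have hhigh' := hhigh s le_rfl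
  have hs := hT (r + s)
  rw [abs_le] at ha hb
  rcases neg_one_pow_eq_or M r with h | h <;> rw [h] <;> linarith [ha.1, ha.2, hb.1, hb.2]

/-- Alternating sums of exponentials with prescribed dominant terms. -/
lemma exists_coeff_sign {d : ℕ} {n : ℕ → ℕ} (hn : ∀ i < d, n i < n (i + 1)) {r : ℕ → ℕ}
    (hr : Monotone r) (hrd : ∀ t, r t ≤ d) (N : ℕ) : ∃ h : ℕ → ℤ, ∀ t < N,
      0 < (-1) ^ r t * ∑ i ∈ Finset.range (d + 1), (-1) ^ i * ((3 : M) ^ h i * 9 ^ (t * n i)) := by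
  classical
  -- As `r` is monotone, it passes `i` at one time, capped at `N`.
  have hcut : ∀ i, ∃ c, ∀ t < N, i + 1 ≤ r t ↔ c ≤ t := by
    intro i
    have hex : ∃ t, N ≤ t ∨ i + 1 ≤ r t := ⟨N, Or.inl le_rfl⟩
    refine ⟨Nat.find hex, fun t ht => ⟨fun h => Nat.find_min' hex (Or.inr h), fun h => ?_⟩⟩
    rcases Nat.find_spec hex with h1 | h1
    · omega
    · exact h1.trans (hr h)
  choose c hc using hcut
  -- At time `t` the exponents of 3 in terms `i + 1` and `i` differ by `(n (i + 1) - n i) * (2 * t -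
  -- 2 * c i + 1)`. The last factor is odd, so it is at least 1 for `t ≥ c i` and at most -1 before.
  let h : ℕ → ℤ := fun i =>
    -∑ j ∈ Finset.range i, ((n (j + 1) : ℤ) - n j) * (2 * c j - 1)
  have hsucc : ∀ i, h (i + 1) = h i - ((n (i + 1) : ℤ) - n i) * (2 * c i - 1) := by
    intro i
    simp only [h, Finset.sum_range_succ]
    ring
  refine ⟨h, fun t ht => ?_⟩
  have hT : ∀ i, (3 : M) ^ h i * 9 ^ (t * n i) = 3 ^ (h i + 2 * t * n i) := by
    intro i
    rw [zpow_add₀ (by norm_num), show (9 : M) = 3 ^ 2 by norm_num, ← pow_mul,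
      show (2 * t * n i : ℤ) = ((2 * (t * n i) : ℕ) : ℤ) by push_cast; ring, zpow_natCast]
  simp only [hT]
  have h3 : ∀ x : ℤ, 3 * (3 : M) ^ x = 3 ^ (x + 1) := fun x => by
    rw [zpow_add_one₀ (by norm_num), mul_comm]
  refine sign_sum_of_dominant (hrd t) (fun i => by positivity) (fun i hi => ?_)
    (fun i hi hid => ?_)
  · rw [h3]
    refine zpow_le_zpow_right₀ (by norm_num) ?_
    have h1 : (c i : ℤ) ≤ t := by exact_mod_cast (hc i t ht).1 hi
    have h2 : (n i : ℤ) + 1 ≤ n (i + 1) := by exact_mod_cast hn i (hi.trans_le (hrd t))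
    rw [hsucc]
    nlinarith
  · rw [h3]
    refine zpow_le_zpow_right₀ (by norm_num) ?_
    have h1 : (t : ℤ) + 1 ≤ c i := by
      have : t < c i := not_le.1 fun h => absurd ((hc i t ht).2 h) (by omega)
      exact_mod_cast this
    have h2 : (n i : ℤ) + 1 ≤ n (i + 1) := by exact_mod_cast hn i hid
    rw [hsucc]
    nlinarith

theorem tracesMaximum_of_polyValue {L : FirstOrder.Language.{u, v}} [L.Structure M] {d k : ℕ}
    (hk : 1 ≤ k) {e : Fin (d + 1) → Fin k → ℕ} (he : Function.Injective e)
    {φ : L.Formula (Fin d ⊕ Fin k)}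
    (hφ : ∀ (c : Fin d → M) (a : Fin k → M), φ.Realize (Sum.elim c a) ↔ 0 ≤ polyValue e c a) :
    TracesMaximum M φ d := by
  classical
  obtain ⟨B, hB⟩ : ∃ B, ∀ i j, e i j < B :=
    ⟨(Finset.univ.sup fun q : Fin (d + 1) × Fin k => e q.1 q.2) + 1, fun i j => Nat.lt_succ_of_le
      (Finset.le_sup (f := fun q : Fin (d + 1) × Fin k => e q.1 q.2) (Finset.mem_univ (i, j)))⟩
  -- Reading exponent vectors as base `B` digits keeps distinct monomials distinct on the points `a
  -- t`.
  let m : Fin (d + 1) → ℕ := fun i => ∑ j, e i j * B ^ (j : ℕ)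
  have hm : Function.Injective m := by
    intro i i' hii
    have h1 : ∀ i, m i = finFunctionFinEquiv fun j => (⟨e i j, hB i j⟩ : Fin B) := fun i => by
      rw [finFunctionFinEquiv_apply]
    rw [h1, h1] at hii
    have h2 := finFunctionFinEquiv.injective (Fin.ext hii)
    exact he (funext fun j => congrArg Fin.val (congrFun h2 j))
  let σ := Tuple.sort m
  have hσ : StrictMono (m ∘ σ) :=
    (Tuple.monotone_sort m).strictMono_of_injective (hm.comp σ.injective)
  let n : ℕ → ℕ := fun i => if h : i < d + 1 then m (σ ⟨i, h⟩) else 0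
  have hn : ∀ i < d, n i < n (i + 1) := by
    intro i hi
    simp only [n]
    rw [dif_pos (by omega), dif_pos (by omega)]
    exact hσ (Fin.mk_lt_mk.2 (Nat.lt_succ_self i))
  let a : ℕ → Fin k → M := fun t j => 9 ^ (t * B ^ (j : ℕ))
  have ha : Function.Injective a := by
    intro s t hst
    have h1 := congrFun hst ⟨0, hk⟩
    simp only [a, pow_zero, mul_one] at h1
    exact pow_right_injective₀ (by norm_num) (by norm_num) h1
  have hmono : ∀ t i, ∏ j, a t j ^ e i j = 9 ^ (t * m i) := by
    intro t i
    simp only [a, ← pow_mul, m, Finset.mul_sum]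
    rw [Finset.prod_pow_eq_pow_sum]
    congr 1
    exact Finset.sum_congr rfl fun j _ => by ring
  -- Dividing by the coefficient of the zeroth monomial, which sits at place `i₀` after sorting,
  -- makes it 1 and shifts the parity of the signs by `i₀`.
  let i₀ : ℕ := (σ.symm 0 : Fin (d + 1))
  let c : ℕ → Bool := fun j => decide (Even (j + i₀))
  refine tracesMaximum_of_word ha c fun p hp N => ?_
  obtain ⟨h, hh⟩ := exists_coeff_sign (M := M) hn (r := fun t => mistakes p (t + 1))
    (fun s t hst => mistakes_mono p (by omega)) (fun t => hp _) N
  let g : ℕ → M := fun i => (-1) ^ i * 3 ^ h i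
  have hg : ∀ i, g i ≠ 0 := fun i => mul_ne_zero (pow_ne_zero _ (by norm_num)) (by positivity)
  refine ⟨fun i => g (σ.symm i.succ : Fin (d + 1)) / g i₀, fun t => ?_⟩
  have hval : polyValue e (fun i => g (σ.symm i.succ : Fin (d + 1)) / g i₀) (a t) =
      (g i₀)⁻¹ * ∑ i ∈ Finset.range (d + 1), (-1) ^ i * (3 ^ h i * 9 ^ ((t : ℕ) * n i)) := by
    have h1 : polyValue e (fun i => g (σ.symm i.succ : Fin (d + 1)) / g i₀) (a t) =
        ∑ i : Fin (d + 1), g (σ.symm i : Fin (d + 1)) / g i₀ * 9 ^ ((t : ℕ) * m i) := by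
      rw [Fin.sum_univ_succ, polyValue]
      simp only [hmono]
      rw [show g (σ.symm 0 : Fin (d + 1)) / g i₀ = 1 from div_self (hg _), one_mul]
    rw [h1, ← Equiv.sum_comp σ, Finset.sum_range, Finset.mul_sum]
    refine Finset.sum_congr rfl fun i _ => ?_
    rw [Equiv.symm_apply_apply]
    simp only [n, Fin.is_lt, dite_true, Fin.eta, g]
    ring
  rw [hφ, hval]
  have hpos := hh t t.2
  set S := ∑ i ∈ Finset.range (d + 1), (-1) ^ i * ((3 : M) ^ h i * 9 ^ ((t : ℕ) * n i))
  -- For alternating `c` a mistake flips the letter and all later guesses, so the letter at `t` is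
  -- the parity of the mistakes up to and including `t`.
  have hword : word c p t = decide (Even (mistakes p (t + 1) + i₀)) := by
    simp only [word, c, mistakes_succ]
    cases p t
    · simp
    · rw [if_pos rfl, add_right_comm, Bool.xor_true, ← decide_not]
      exact decide_eq_decide.2 Nat.even_add_one.symm
  have h3 : (0 : M) < 3 ^ h i₀ := by positivity
  have hginv : (g i₀)⁻¹ = (-1) ^ i₀ * (3 ^ h i₀)⁻¹ := by
    simp only [g, mul_inv]
    rcases neg_one_pow_eq_or M i₀ with h' | h' <;> rw [h'] <;> norm_num
  have h4 : (g i₀)⁻¹ * S = (-1) ^ (mistakes p (t + 1) + i₀) *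
      ((3 ^ h i₀)⁻¹ * ((-1) ^ mistakes p (t + 1) * S)) := by
    rw [hginv, pow_add]
    rcases neg_one_pow_eq_or M (mistakes p (t + 1)) with h' | h' <;> rw [h'] <;> ring
  have h5 : 0 < (3 ^ h i₀)⁻¹ * ((-1) ^ mistakes p (t + 1) * S) := mul_pos (inv_pos.2 h3) hpos
  rw [h4]
  beta_reduce
  rw [hword, decide_eq_true_iff]
  rcases Nat.even_or_odd (mistakes p (t + 1) + i₀) with h' | h'
  · rw [h'.neg_one_pow, one_mul]
    exact iff_of_true h5.le h'
  · rw [h'.neg_one_pow, neg_one_mul]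
    exact iff_of_false (by linarith) (Nat.not_even_iff_odd.2 h')

/-- The densities of a polynomial inequality with `d` free coefficients are both `d`. -/
theorem vcd_eq_of_polyValue {L : FirstOrder.Language.{u, v}} [L.Structure M] {κ : Cardinal.{w}}
    (hκ : ℵ₀ ≤ κ) (hM : IsSaturated L M κ) {d k : ℕ} (hk : 1 ≤ k) {e : Fin (d + 1) → Fin k → ℕ}
    (he : Function.Injective e) {φ : L.Formula (Fin d ⊕ Fin k)}
    (hφ : ∀ (c : Fin d → M) (a : Fin k → M), φ.Realize (Sum.elim c a) ↔ 0 ≤ polyValue e c a) :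
    VCd M φ = (d : EReal) ∧ VCdInd M φ = (d : EReal) := by
  have : Infinite M := Infinite.of_injective _ (Nat.cast_injective (R := M))
  have h1 : VCd M φ ≤ d := sInf_le ⟨d, vcDensityBound_of_polyValue hφ, rfl⟩
  have h2 : (d : EReal) ≤ VCdInd M φ := by
    have := coe_le_vcdInd_of_tracesMaximum hκ hM (tracesMaximum_of_polyValue hk he hφ)
    rwa [coe_natCast_eq] at this
  have h3 := vcdInd_le_vcd (M := M) hk φ
  exact ⟨le_antisymm h1 (h2.trans h3), le_antisymm (h3.trans h1) h2⟩

end Polynomial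

end

end VCMax

theorem mainTheorem2 :
    -- the characterization, for an arbitrary formula in a saturated infinite structure
    (∀ (L : FirstOrder.Language.{u, v}) (M : Type w) [L.Structure M] [Infinite M]
      (κ : Cardinal.{w}), Cardinal.aleph0 ≤ κ → VCMax.IsSaturated L M κ →
      ∀ (l k : ℕ), 1 ≤ k → ∀ φ : L.Formula (Fin l ⊕ Fin k),
        (VCMax.VCd M φ = VCMax.VCdInd M φ ↔
          ∃ d : ℕ∞, VCMax.VCd M φ = ((d : ENNReal) : EReal) ∧
            ∃ (A : Set (Fin k → M)) (𝒞 : Set (Set (Fin k → M))),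
              A.Infinite ∧ VCMax.Traces φ A 𝒞 ∧ VCMax.IsMaximum d A 𝒞)) ∧
    -- polynomial inequalities in a saturated real closed field
    (∀ (M : Type w) [Field M] [LinearOrder M] [IsStrictOrderedRing M] [IsRealClosed M]
      [FirstOrder.Ring.CompatibleRing M] (κ : Cardinal.{w}), Cardinal.aleph0 ≤ κ →
      VCMax.IsSaturated FirstOrder.Language.ring M κ →
      ∀ (d k : ℕ), 1 ≤ k → ∀ e : Fin (d + 1) → Fin k → ℕ, Function.Injective e →
        ∀ φ : FirstOrder.Language.ring.Formula (Fin d ⊕ Fin k),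
          (∀ (c : Fin d → M) (a : Fin k → M),
            φ.Realize (Sum.elim c a) ↔ 0 ≤ VCMax.polyValue e c a) →
          VCMax.VCd M φ = (d : EReal) ∧ VCMax.VCdInd M φ = (d : EReal)) := by
  refine ⟨?_, ?_⟩
  · intro L M _ _ κ hκ hM l k hk φ
    exact VCMax.vcd_eq_vcdInd_iff hκ hM hk φ
  · intro M _ _ _ _ _ κ hκ hM d k hk e he φ hφ
    exact VCMax.vcd_eq_of_polyValue hκ hM hk he hφ
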